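/- Let $\mathbb F_q$ be a finite field with $q$ elements, $K$ the function field of a geometrically connected smooth projective curve $X$ over $\mathbb F_q$, $\infty$ a place of $K$ of degree one with normalized valuation $v_\infty$, $\deg:=-v_\infty$, and $A\subset K$ the ring of functions regular away from $\infty$. Let $K_\infty$ be the completion of $K$ at $\infty$ and $\mathbb C_\infty$ the completion of an algebraic closure of $K_\infty$, with absolute value $|x|=q^{\deg x}$. Fix a uniformizer $\pi$ of $K_\infty$, so that $K_\infty=\mathbb F_q((\pi))$; call $a\in A\setminus\{0\}$ monic if its leading coefficient as a Laurent series in $\pi$ is $1$, and let $A_{+,i}$ be the (finite) set of monic $a\in A$ with $\deg a=i$. For $i\ge 0$ and $n\ge 1$ put $$S_i(n)=\sum_{a\in A_{+,i}}\frac1{a^n}\in K,\qquad \mathcal S_i=\sum_{a\in A_{+,i}}a\otimes \frac1a\in A\otimes_{\mathbb F_q}K,\qquad \mathcal S_{\le i}=\sum_{j=0}^{i}\mathcal S_j ,$$ and let $f\mapsto f^{(1)}$ be the map $a\otimes c\mapsto a\otimes c^q$ on $A\otimes_{\mathbb F_q}K$. Then for all $i\ge 0$ $$\mathcal S_i^{(1)}=\mathcal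 S_{\le i}\cdot S_i(q-1)\quad\text{in } A\otimes_{\mathbb F_q}K .$$ As a consequence, let $(\beta_j)_{j}$ be any $\mathbb F_q$-basis of $A$ whose elements have pairwise distinct degrees. Let the Tate algebra $\mathbb T$ be the completion of $A\otimes_{\mathbb F_q}\mathbb C_\infty$ for the Gauss norm, that is, the space of formal series $f=\sum_j\beta_jf_j$ with $f_j\in\mathbb C_\infty$, $f_j\to0$, normed by $\sup_j|f_j|$. Then the series $Z_0=\sum_{d\ge0}\mathcal S_d$ converges in $\mathbb T$, and its sum is an entire function on $X(\mathbb C_\infty)\setminus\{\infty\}$: its coefficients $f_j$ satisfy $|f_j|\rho^{\deg\beta_j}\to0$ for every $\rho>1$. Identify a point $x\in X(\mathbb C_\infty)\setminus\{\infty\}$ with its evaluation homomorphism $\chi_x:A\to\mathbb C_\infty$, let $\Xi$ be the point given by the inclusion $A\subset\mathbb C_\infty$ and, for $k\ge1$, let $\Xi^{(k)}$ be its image under the $k$-th iterate of Frobenius, so that $\chi_{\Xi^{(k)}}(a)=a^{q^k}$. With $f|_x=\sum_jf_j\chi_x(\beta_j)$ (a convergent series at these points), one has $$Z_0|_{\Xi^{(k)}}=0\quad\text{for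 all }k\ge1,\qquad Z_0|_{\Xi}=1 .$$ -/

import Mathlib

open scoped TensorProduct ENNReal Topology WithZero
open Filter

/-- `K` is the function field of a geometrically connected smooth projective curve over the finite
field `F`: a finitely generated extension of transcendence degree one in which `F` is
algebraically closed. -/
class IsCurveFunctionField (F K : Type*) [Field F] [Field K] [Algebra F K] : Prop where
  fg : (⊤ : IntermediateField F K).FG
  trdeg_eq_one : Algebra.trdeg F K = 1
  mem_range_of_isAlgebraic : ∀ x : K, IsAlgebraic F x → x ∈ (algebraMap F K).range

/-- A place of `K / F` of degree one, given by its normalized valuation, written multiplicatively: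
`val x = exp (- v_∞ x)` for `x ≠ 0`. -/
structure RationalPlace (F K : Type*) [Field F] [Field K] [Algebra F K] where
  val : Valuation K ℤᵐ⁰
  val_surjective : Function.Surjective val
  val_algebraMap : ∀ c : F, c ≠ 0 → val (algebraMap F K c) = 1
  exists_residue : ∀ x : K, val x ≤ 1 → ∃ c : F, val (x - algebraMap F K c) < 1

namespace RationalPlace

noncomputable section

variable {F K : Type*} [Field F] [Field K] [Algebra F K] (P : RationalPlace F K)

/-- The degree `deg x = - v_∞ x` (with the junk value `0` at `x = 0`). -/
def deg (x : K) : ℤ := WithZero.log (P.val x)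

/-- The base ring `A`: the elements of `K` that are regular at every place of `K / F` other than
`∞`. (The trivial valuation ring `K` imposes no condition.) -/
def baseRing : Subalgebra F K where
  carrier := {x | ∀ V : ValuationSubring K, (∀ c : F, algebraMap F K c ∈ V) →
    V ≠ P.val.valuationSubring → x ∈ V}
  mul_mem' hx hy V hV hne := V.mul_mem _ _ (hx V hV hne) (hy V hV hne)
  add_mem' hx hy V hV hne := V.add_mem _ _ (hx V hV hne) (hy V hV hne)
  algebraMap_mem' c _ hV _ := hV c

/-! ### Degrees of elements of the base ring -/

lemma val_eq_exp_deg {x : K} (hx : x ≠ 0) : P.val x = WithZero.exp (P.deg x) :=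
  (WithZero.exp_log ((P.val.ne_zero_iff).2 hx)).symm

/-- A nonzero element of the base ring that is regular at `∞` has degree zero. -/
lemma val_eq_one_of_le_one {x : K} (hA : x ∈ P.baseRing) (hx0 : x ≠ 0) (hx : P.val x ≤ 1) :
    P.val x = 1 := by
  have hall : ∀ V : ValuationSubring K, (∀ c : F, algebraMap F K c ∈ V) → x ∈ V := by
    intro V hV
    by_cases h : V = P.val.valuationSubring
    · rw [h]; exact hx
    · exact hA V hV h
  have hint : IsIntegral F x := by
    have key := iInf_valuationSubring_superset (K := K) (s := Set.range (algebraMap F K))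
    have hmem : x ∈ (⨅ V : {V : ValuationSubring K // Set.range (algebraMap F K) ⊆ V.toSubring},
        V.1.toSubring) := by
      rw [Subring.mem_iInf]
      rintro ⟨V, hV⟩
      exact hall V fun c => hV ⟨c, rfl⟩
    rw [key] at hmem
    have h1 : IsIntegral (Subring.closure (Set.range (algebraMap F K))) x := hmem
    have hcl : Subring.closure (Set.range (algebraMap F K)) = (algebraMap F K).range := by
      rw [← RingHom.coe_range]; exact Subring.closure_eq _
    rw [hcl] at h1
    obtain ⟨p, hp, hpx⟩ := h1
    obtain ⟨r, hr, -, hrm⟩ := Polynomial.lifts_and_natDegree_eq_and_monic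
      (f := (algebraMap F K).rangeRestrict) (p := p)
      (by
        rw [Polynomial.lifts_iff_coeff_lifts]
        intro n
        obtain ⟨c, hc⟩ := (p.coeff n).2
        exact ⟨c, Subtype.ext hc⟩) hp
    refine ⟨r, hrm, ?_⟩
    rw [← hr, Polynomial.eval₂_map] at hpx
    exact hpx
  refine le_antisymm hx ?_
  by_contra hlt
  have hlt' : P.val x < 1 := not_le.1 hlt
  have hint' : IsIntegral F x⁻¹ := hint.inv
  have hle : P.val x⁻¹ ≤ 1 := by
    have hF : ∀ c : F, algebraMap F K c ∈ P.val.valuationSubring := by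
      intro c
      change P.val _ ≤ 1
      by_cases hc : c = 0
      · simp [hc]
      · exact (P.val_algebraMap c hc).le
    have hmem : x⁻¹ ∈ (⨅ V : {V : ValuationSubring K // Set.range (algebraMap F K) ⊆ V.toSubring},
        V.1.toSubring) := by
      rw [iInf_valuationSubring_superset]
      obtain ⟨p, hp, hpx⟩ := hint'
      let f : F →+* Subring.closure (Set.range (algebraMap F K)) :=
        (algebraMap F K).codRestrict _ fun c => Subring.subset_closure ⟨c, rfl⟩
      refine ⟨p.map f, hp.map f, ?_⟩
      rw [Polynomial.eval₂_map]
      exact hpx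
    rw [Subring.mem_iInf] at hmem
    exact hmem ⟨P.val.valuationSubring, by rintro _ ⟨c, rfl⟩; exact hF c⟩
  rw [map_inv₀] at hle
  have hpos : 0 < P.val x := zero_lt_iff.2 ((P.val.ne_zero_iff).2 hx0)
  have := mul_lt_mul_of_pos_right hlt' (inv_pos.2 hpos)
  rw [mul_inv_cancel₀ hpos.ne', one_mul] at this
  exact absurd hle (not_le.2 this)


lemma deg_nonneg {x : K} (hA : x ∈ P.baseRing) : 0 ≤ P.deg x := by
  by_contra h
  have hx0 : x ≠ 0 := by rintro rfl; simp [deg] at h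
  have h1 : P.val x < 1 := by
    rw [P.val_eq_exp_deg hx0, ← WithZero.exp_zero, WithZero.exp_lt_exp]; omega
  exact h1.ne (P.val_eq_one_of_le_one hA hx0 h1.le)

lemma val_smul {c : F} (hc : c ≠ 0) (x : K) : P.val (c • x) = P.val x := by
  rw [Algebra.smul_def, map_mul, P.val_algebraMap c hc, one_mul]

/-- If `val x ≤ val y` and `y ≠ 0`, then subtracting a constant multiple of `y` from `x` brings the
valuation strictly below that of `y`. -/
lemma exists_smul_sub_lt {x y : K} (hy : y ≠ 0) (h : P.val x ≤ P.val y) :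
    ∃ c : F, P.val (x - c • y) < P.val y := by
  have hy' : 0 < P.val y := zero_lt_iff.2 ((P.val.ne_zero_iff).2 hy)
  obtain ⟨c, hc⟩ := P.exists_residue (x / y) (by rw [map_div₀]; exact div_le_one_of_le₀ h hy'.le)
  refine ⟨c, ?_⟩
  have : x - c • y = (x / y - algebraMap F K c) * y := by
    rw [Algebra.smul_def]; field_simp
  rw [this, map_mul]
  simpa using mul_lt_mul_of_pos_right hc hy'

lemma finite_val_lt [Finite F] (d : ℕ) :
    {a : P.baseRing | P.val (a : K) < WithZero.exp (d : ℤ)}.Finite := by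
  induction d with
  | zero =>
    refine (Set.finite_singleton (0 : P.baseRing)).subset fun a ha => ?_
    by_contra h
    have h0 : (a : K) ≠ 0 := fun h' => h (Subtype.ext h')
    simp only [Nat.cast_zero, WithZero.exp_zero, Set.mem_ofPred_eq] at ha
    exact ha.ne (P.val_eq_one_of_le_one a.2 h0 ha.le)
  | succ d ih =>
    by_cases hη : ∃ η : P.baseRing, P.val (η : K) = WithZero.exp (d : ℤ)
    · obtain ⟨η, hη⟩ := hη
      have hη0 : (η : K) ≠ 0 := by
        intro h; rw [h, map_zero] at hη; exact WithZero.exp_ne_zero hη.symm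
      refine ((Set.finite_univ (α := F)).prod ih |>.image fun p => p.2 + p.1 • η).subset ?_
      intro a ha
      have hle : P.val (a : K) ≤ P.val (η : K) := by
        by_cases h0 : (a : K) = 0
        · rw [h0, map_zero]; exact zero_le
        · rw [hη, P.val_eq_exp_deg h0, WithZero.exp_le_exp]
          rw [Set.mem_ofPred_eq, P.val_eq_exp_deg h0, WithZero.exp_lt_exp] at ha
          push_cast at ha; omega
      obtain ⟨c, hc⟩ := P.exists_smul_sub_lt hη0 hle
      exact ⟨(c, a - c • η), ⟨trivial, by rw [← hη]; exact hc⟩, by simp⟩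
    · refine ih.subset fun a ha => ?_
      by_cases h0 : (a : K) = 0
      · rw [Set.mem_ofPred_eq, h0, map_zero]; exact WithZero.exp_pos
      · have hne : P.val (a : K) ≠ WithZero.exp (d : ℤ) := fun h => hη ⟨a, h⟩
        rw [Set.mem_ofPred_eq] at ha ⊢
        rw [P.val_eq_exp_deg h0, WithZero.exp_lt_exp] at ha ⊢
        rw [P.val_eq_exp_deg h0, Ne, WithZero.exp_inj] at hne
        push_cast at ha; omega

/-- The base ring has an `F`-basis consisting of elements of pairwise distinct degrees. -/
theorem exists_basis_deg_injective :
    ∃ (J : Set ℤ) (β : Module.Basis J F P.baseRing),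
      Function.Injective fun j => P.deg (β j : K) := by
  let J : Set ℤ := {n | ∃ a : P.baseRing, P.val (a : K) = WithZero.exp n}
  choose b hb using fun j : J => j.2
  have hb0 : ∀ j, (b j : K) ≠ 0 := fun j h => by
    have := hb j; rw [h, map_zero] at this; exact WithZero.exp_ne_zero this.symm
  have hli : LinearIndependent F b := by
    classical
    rw [linearIndependent_iff']
    intro s g hg
    by_contra hne
    push Not at hne
    obtain ⟨i, hi, hgi⟩ := hne
    obtain ⟨m, hm, hmax⟩ := (s.filter fun j => g j ≠ 0).exists_max_image (fun j => (j : ℤ))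
      ⟨i, by simp [hi, hgi]⟩
    rw [Finset.mem_filter] at hm
    have hsum : g m • (b m : K) + ∑ j ∈ s.erase m, g j • (b j : K) = 0 := by
      rw [Finset.add_sum_erase s (fun j => g j • (b j : K)) hm.1]
      have := congrArg (Subtype.val) hg
      simpa using this
    have hlt : P.val (∑ j ∈ s.erase m, g j • (b j : K)) < P.val (g m • (b m : K)) := by
      rw [P.val_smul hm.2, hb m]
      refine P.val.map_sum_lt WithZero.exp_ne_zero fun j hj => ?_
      by_cases hgj : g j = 0
      · rw [hgj, zero_smul, map_zero]; exact WithZero.exp_pos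
      · rw [P.val_smul hgj, hb j, WithZero.exp_lt_exp]
        have h1 := hmax j (by simp [Finset.mem_of_mem_erase hj, hgj])
        exact lt_of_le_of_ne h1 fun h => Finset.ne_of_mem_erase hj (Subtype.ext h)
    rw [← neg_eq_of_add_eq_zero_right hsum, Valuation.map_neg] at hlt
    exact lt_irrefl _ hlt
  have hspan : ∀ (d : ℕ) (a : P.baseRing), P.val (a : K) < WithZero.exp (d : ℤ) →
      a ∈ Submodule.span F (Set.range b) := by
    intro d
    induction d with
    | zero =>
      intro a ha
      rw [Nat.cast_zero, WithZero.exp_zero] at ha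
      have : a = 0 := by
        by_contra h
        exact ha.ne (P.val_eq_one_of_le_one a.2 (fun h' => h (Subtype.ext h')) ha.le)
      rw [this]; exact Submodule.zero_mem _
    | succ d ih =>
      intro a ha
      by_cases h0 : (a : K) = 0
      · rw [show a = 0 from Subtype.ext h0]; exact Submodule.zero_mem _
      let j : J := ⟨P.deg (a : K), a, P.val_eq_exp_deg h0⟩
      have hj : P.val (b j : K) = P.val (a : K) := by rw [hb j, P.val_eq_exp_deg h0]
      obtain ⟨c, hc⟩ := P.exists_smul_sub_lt (hb0 j) hj.ge
      have hlt : P.val ((a - c • b j : P.baseRing) : K) < WithZero.exp (d : ℤ) := by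
        have hc' : P.val ((a - c • b j : P.baseRing) : K) < P.val (a : K) := by
          rw [← hj]; exact hc
        by_cases h1 : ((a - c • b j : P.baseRing) : K) = 0
        · rw [h1, map_zero]; exact WithZero.exp_pos
        · rw [P.val_eq_exp_deg h1] at hc' ⊢
          rw [P.val_eq_exp_deg h0, WithZero.exp_lt_exp] at hc' ha
          rw [WithZero.exp_lt_exp]
          push_cast at ha; omega
      have h2 := ih _ hlt
      have h3 := Submodule.add_mem _ h2
        (Submodule.smul_mem _ c (Submodule.subset_span (Set.mem_range_self j)))
      rwa [sub_add_cancel] at h3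
  refine ⟨J, Module.Basis.mk hli fun a _ => ?_, ?_⟩
  · by_cases h0 : (a : K) = 0
    · rw [show a = 0 from Subtype.ext h0]; exact Submodule.zero_mem _
    · refine hspan ((P.deg (a : K)).toNat + 1) a ?_
      rw [P.val_eq_exp_deg h0, WithZero.exp_lt_exp]
      push_cast
      have := Int.self_le_toNat (P.deg (a : K)); omega
  · intro i j hij
    simp only [Module.Basis.mk_apply, deg, hb, WithZero.log_exp] at hij
    exact Subtype.ext hij

/-! ### The fields `K_∞` and `ℂ_∞` -/

section Completion

variable [Fintype F]

lemma one_lt_card : (1 : NNReal) < (Fintype.card F : NNReal) := by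
  exact_mod_cast Fintype.one_lt_card (α := F)

/-- The absolute value `|x| = q ^ deg x` on `K`, where `q` is the number of elements of `F`. -/
def absVal : AbsoluteValue K ℝ where
  toFun x := (WithZeroMulInt.toNNReal (one_pos.trans (one_lt_card (F := F))).ne' (P.val x) : ℝ)
  map_mul' x y := by simp
  nonneg' x := NNReal.coe_nonneg _
  eq_zero' x := by simp
  add_le' x y := by
    have hmono := (WithZeroMulInt.toNNReal_strictMono (one_lt_card (F := F))).monotone
    have h := hmono (P.val.map_add x y)
    rw [hmono.map_max] at h
    exact_mod_cast h.trans (max_le_add_of_nonneg zero_le zero_le)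

/-- The completion `K_∞` of `K` at `∞`. -/
abbrev Kinf : Type _ := P.absVal.Completion

lemma absVal_add_le_max (x y : K) : P.absVal (x + y) ≤ max (P.absVal x) (P.absVal y) := by
  have hmono := (WithZeroMulInt.toNNReal_strictMono (one_lt_card (F := F))).monotone
  have h := hmono (P.val.map_add x y)
  rw [hmono.map_max] at h
  exact_mod_cast h

lemma norm_algebraMap (x : K) : ‖algebraMap K P.Kinf x‖ = P.absVal x := by
  change ‖((WithAbs.toAbs P.absVal x : WithAbs P.absVal) : P.Kinf)‖ = _
  rw [UniformSpace.Completion.norm_coe]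
  rfl

instance : IsUltrametricDist (WithAbs P.absVal) :=
  IsUltrametricDist.isUltrametricDist_of_forall_norm_add_le_max_norm fun x y =>
    P.absVal_add_le_max x.ofAbs y.ofAbs

instance : IsUltrametricDist P.Kinf := by
  refine IsUltrametricDist.isUltrametricDist_of_forall_norm_add_le_max_norm fun x y => ?_
  induction x, y using UniformSpace.Completion.induction_on₂ with
  | hp => exact isClosed_le (by fun_prop) (by fun_prop)
  | ih x y =>
    rw [← UniformSpace.Completion.coe_add]
    simp only [UniformSpace.Completion.norm_coe]
    exact IsUltrametricDist.norm_add_le_max x y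

instance : NontriviallyNormedField P.Kinf where
  non_trivial := by
    obtain ⟨x, hx⟩ := P.val_surjective (WithZero.exp 1)
    refine ⟨algebraMap K P.Kinf x, ?_⟩
    rw [norm_algebraMap]
    change (1 : ℝ) < (WithZeroMulInt.toNNReal _ (P.val x) : ℝ)
    have h := WithZeroMulInt.toNNReal_strictMono (one_lt_card (F := F))
      (show (1 : ℤᵐ⁰) < P.val x by rw [hx, ← WithZero.exp_zero, WithZero.exp_lt_exp]; omega)
    rw [map_one] at h
    exact_mod_cast h

/-- An algebraic closure of `K_∞`. -/
abbrev KinfAlg : Type _ := AlgebraicClosure P.Kinf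

/-- The unique extension of the absolute value of `K_∞` to its algebraic closure. -/
instance : NormedField P.KinfAlg := spectralNorm.normedField P.Kinf P.KinfAlg

instance : NormedAlgebra P.Kinf P.KinfAlg := spectralNorm.normedAlgebra P.Kinf P.KinfAlg

instance (R : Type*) [CommSemiring R] [Algebra R P.KinfAlg] :
    UniformContinuousConstSMul R P.KinfAlg where
  uniformContinuous_const_smul r := by
    simp_rw [Algebra.smul_def]
    exact (Ring.uniformContinuousConstSMul _).uniformContinuous_const_smul _

/-- The field `ℂ_∞`, the completion of an algebraic closure of `K_∞`. -/
abbrev Cinf : Type _ := UniformSpace.Completion P.KinfAlg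

/-! ### Sign and monic elements -/

/-- `π` is a uniformizer of `K_∞`. -/
def IsUniformizer (π : P.Kinf) : Prop := ‖π‖ = (Fintype.card F : ℝ)⁻¹

open Classical in
/-- The sign function of `K_∞` attached to the uniformizer `π`: the sign of `x ≠ 0` is the leading
coefficient `c` of `x = c π ^ n + ⋯ ∈ F((π))`. By convention the sign of `0` is `0`. -/
def sgn (π x : P.Kinf) : F :=
  if h : ∃ c : F, c ≠ 0 ∧ ∃ n : ℤ, ‖x - algebraMap F P.Kinf c * π ^ n‖ < ‖x‖ then h.choose else 0

lemma norm_algebraMap_base {c : F} (hc : c ≠ 0) : ‖algebraMap F P.Kinf c‖ = 1 := by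
  rw [IsScalarTower.algebraMap_apply F K P.Kinf, norm_algebraMap]
  change (WithZeroMulInt.toNNReal _ (P.val (algebraMap F K c)) : ℝ) = 1
  rw [P.val_algebraMap c hc, map_one, NNReal.coe_one]

/-- The sign is well defined: the leading coefficient is unique. -/
lemma sgn_eq_of_lt {π : P.Kinf} (hπ : P.IsUniformizer π) {x : P.Kinf} {c : F} (hc : c ≠ 0) {n : ℤ}
    (h : ‖x - algebraMap F P.Kinf c * π ^ n‖ < ‖x‖) : P.sgn π x = c := by
  have hex : ∃ c : F, c ≠ 0 ∧ ∃ n : ℤ, ‖x - algebraMap F P.Kinf c * π ^ n‖ < ‖x‖ := ⟨c, hc, n, h⟩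
  rw [sgn, dif_pos hex]
  obtain ⟨hc', m, h'⟩ := hex.choose_spec
  generalize hex.choose = c' at hc' h' ⊢
  have key : ∀ {c : F} {n : ℤ}, c ≠ 0 → ‖x - algebraMap F P.Kinf c * π ^ n‖ < ‖x‖ →
      ‖x‖ = ‖π ^ n‖ := by
    intro c n hc h
    rw [sub_eq_add_neg] at h
    have h1 := IsUltrametricDist.norm_eq_of_add_norm_lt_max (h.trans_le (le_max_left _ _))
    rwa [norm_neg, norm_mul, P.norm_algebraMap_base hc, one_mul] at h1
  have hq : (1 : ℝ) < Fintype.card F := by exact_mod_cast Fintype.one_lt_card (α := F)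
  have hnm : m = n := by
    have h1 := (key hc' h').symm.trans (key hc h)
    rw [norm_zpow, norm_zpow, hπ] at h1
    exact zpow_right_injective₀ (inv_pos.2 (one_pos.trans hq)) (inv_lt_one_of_one_lt₀ hq).ne h1
  subst hnm
  by_contra hne
  have h2 : ‖(x - algebraMap F P.Kinf c * π ^ m) + -(x - algebraMap F P.Kinf c' * π ^ m)‖ < ‖x‖ := by
    refine (IsUltrametricDist.norm_add_le_max _ _).trans_lt (max_lt h ?_)
    rwa [norm_neg]
  have h3 : (x - algebraMap F P.Kinf c * π ^ m) + -(x - algebraMap F P.Kinf c' * π ^ m) =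
      algebraMap F P.Kinf (c' - c) * π ^ m := by
    rw [map_sub]; ring
  rw [h3, norm_mul, P.norm_algebraMap_base (sub_ne_zero.2 hne), one_mul, key hc h] at h2
  exact lt_irrefl _ h2

/-- The finite set `A_{+,d}` of monic elements of degree `d` of the base ring. -/
def monic (π : P.Kinf) (d : ℕ) : Finset P.baseRing :=
  Set.Finite.toFinset (s := {a : P.baseRing | P.val (a : K) = WithZero.exp (d : ℤ) ∧
      P.sgn π (algebraMap K P.Kinf (a : K)) = 1})
    ((P.finite_val_lt (d + 1)).subset fun a ha => by
      rw [Set.mem_ofPred_eq, ha.1, WithZero.exp_lt_exp]; push_cast; omega)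

/-- The power sum `S_d(n) = ∑_{a ∈ A_{+,d}} 1 / a ^ n ∈ K`. -/
def powerSum (π : P.Kinf) (d n : ℕ) : K := ∑ a ∈ P.monic π d, 1 / (a : K) ^ n

/-- The rational function `𝒮_d = ∑_{a ∈ A_{+,d}} χ(a) / a ∈ A ⊗ K`, where `χ(a) = a ⊗ 1`. -/
def calS (π : P.Kinf) (d : ℕ) : P.baseRing ⊗[F] K := ∑ a ∈ P.monic π d, a ⊗ₜ[F] (1 / (a : K))

/-- `𝒮_{≤ d} = 𝒮_0 + ⋯ + 𝒮_d`. -/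
def calSle (π : P.Kinf) (d : ℕ) : P.baseRing ⊗[F] K := ∑ i ∈ Finset.range (d + 1), P.calS π i

/-- The Frobenius twist `f ↦ f^{(1)}` on `A ⊗ L`: the `A`-linear map with
`a ⊗ c ↦ a ⊗ c ^ q`. -/
def twist (L : Type*) [Field L] [Algebra F L] : P.baseRing ⊗[F] L →ₐ[F] P.baseRing ⊗[F] L :=
  Algebra.TensorProduct.map (AlgHom.id F P.baseRing) (FiniteField.frobeniusAlgHom F L)

/-! ### The points of the affine curve -/

/-- The `ℂ_∞`-points of `X ∖ {∞}`, a point `x` being identified with the evaluation homomorphism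
`χ_x : A → ℂ_∞`. -/
abbrev Point : Type _ := P.baseRing →ₐ[F] P.Cinf

/-- The point `Ξ`, whose evaluation homomorphism is the inclusion of `A` in `ℂ_∞`. -/
def Xi : P.Point := (IsScalarTower.toAlgHom F K P.Cinf).comp P.baseRing.val

/-- The Frobenius map `x ↦ x^{(1)}` on points, `χ_{x^{(1)}}(a) = χ_x(a) ^ q`. -/
def frob (x : P.Point) : P.Point := (FiniteField.frobeniusAlgHom F P.Cinf).comp x

/-! ### The Tate algebra and entire functions -/

/-- The Tate algebra over `ℂ_∞` (the completion of `A ⊗ ℂ_∞` for the Gauss norm), as a normed space: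
with respect to an `F`-basis `(β_i)` of `A`, its elements are the formal series `∑ β_i f_i` with
`f_i → 0` along the cofinite filter, with norm `sup |f_i|`. -/
def tate (ι : Type*) : AddSubgroup (lp (fun _ : ι => P.Cinf) ∞) where
  carrier := {f | Tendsto (fun i => f i) cofinite (𝓝 0)}
  zero_mem' := by simpa using tendsto_const_nhds
  add_mem' hf hg := by simpa using hf.add hg
  neg_mem' hf := by simpa using hf.neg

variable {ι : Type*} (β : Module.Basis ι F P.baseRing)

lemma finite_support_coord (f : P.baseRing ⊗[F] P.Cinf) :
    {i | TensorProduct.lid F P.Cinf ((β.coord i).rTensor P.Cinf f) ≠ 0}.Finite := by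
  classical
  simp_rw [← TensorProduct.equivFinsuppOfBasisLeft_apply]
  exact Finsupp.hasFiniteSupport (TensorProduct.equivFinsuppOfBasisLeft β f)

lemma memℓp_coord (f : P.baseRing ⊗[F] P.Cinf) :
    Memℓp (E := fun _ : ι => P.Cinf)
      (fun i => TensorProduct.lid F P.Cinf ((β.coord i).rTensor P.Cinf f)) ∞ :=
  Memℓp.of_exponent_ge (memℓp_zero (P.finite_support_coord β f)) zero_le

/-- The element of the Tate algebra given by `f ∈ A ⊗ ℂ_∞`: its coefficients `f_i` are those of
the expansion `f = ∑ β_i ⊗ f_i`. -/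
def toTate (f : P.baseRing ⊗[F] P.Cinf) : P.tate ι :=
  ⟨⟨fun i => TensorProduct.lid F P.Cinf ((β.coord i).rTensor P.Cinf f), P.memℓp_coord β f⟩,
    tendsto_nhds_of_eventually_eq (P.finite_support_coord β f)⟩

/-- The function `𝒮_d`, seen in the Tate algebra. -/
def calSTate (π : P.Kinf) (d : ℕ) : P.tate ι :=
  P.toTate β (Algebra.TensorProduct.map (AlgHom.id F P.baseRing)
    (IsScalarTower.toAlgHom F K P.Cinf) (P.calS π d))

/-- The series `Z_0 = ∑_{d ≥ 0} 𝒮_d` in the Tate algebra. -/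
def Z₀ (π : P.Kinf) : P.tate ι := ∑' d, P.calSTate β π d

/-- The series `f = ∑ β_i f_i` is an entire function: `|f_i| ρ ^ deg β_i → 0` for all `ρ > 1`. -/
def IsEntire (f : P.tate ι) : Prop :=
  ∀ ρ : ℝ, 1 < ρ → Tendsto (fun i => ‖f.1 i‖ * ρ ^ P.deg (β i : K)) cofinite (𝓝 0)

/-- The series `∑ f_i χ_x(β_i)` converges in `ℂ_∞`, and its sum, the value `f|_x` of
`f = ∑ β_i f_i` at `x`, is `y`. -/
def HasValueAt (f : P.tate ι) (x : P.Point) (y : P.Cinf) : Prop :=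
  HasSum (fun i => f.1 i * x (β i)) y

end Completion

end

end RationalPlace

/-! ### Finite generation over F(u) and regularity at prescribed places. -/

section

open Polynomial

/-! The functional equation can be tested after applying an F-linear form φ : A → F to the left
tensor factor. If A_{+,i} is nonempty, then A_{<i} and A_{≤i} have q^m and q^(m+1) elements for some
m, and on A_{≤i} the form φ agrees with a q-polynomial ∑_{k≤m} g_k a^(q^k)
(`exists_qpolynomial_interpolation`). Power sums of small exponent over translates of a finite
F-subspace vanish (`sum_add_pow_eq_zero`). Hence the sum of a^(q^k)/a over monic a of degree ≤ i is
1 for k = 0 and 0 for 1 ≤ k ≤ m (`sum_monic_le_pow_eq`), so the φ-coordinate of 𝒮_{≤i} is g_0. The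
same vanishing kills all terms with k ≥ 1 of ∑ φ(a)/a^q over A_{+,i}, which leaves g_0 S_i(q-1)
(`sum_monic_coord_identity`).

For convergence, φ(a)^q = φ(a), so the q-th power of a coordinate of 𝒮_d is a coordinate of its
twist, that is, an element of absolute value at most 1 times S_d(q-1). The latter has absolute value
at most q^(-q^s) as soon as s ≥ 1 and A_{<d} has at least q^(s+1) elements (`val_powerSum_le`).
Since dim A_{<d} grows at least linearly in d, the coordinates of 𝒮_d decay faster than any
exponential in d. As β_i occurs in 𝒮_d only when deg β_i ≤ d, this yields convergence and
entireness. It also makes the double series for Z_0 at Ξ^{(k)} summable, so its value is the limit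
of the values of the partial sums 𝒮_{≤D}, which are eventually 1 or 0 by the vanishing of power
sums.

Linear growth requires a nonconstant element of A (`exists_mem_baseRing_one_lt_val`), a weak form of
Riemann–Roch. It comes from a dimension count: with n = [K : F(u)] and u a uniformizer at ∞, there
is an nN-dimensional space of functions with poles only at zeros of u, whereas the polar conditions
at the zeros other than ∞ number at most (n-1)(N+c). -/

/-- A function field is finite over the subfield generated by a transcendental element. -/
theorem IsCurveFunctionField.finiteDimensional_adjoin {F K : Type*} [Field F] [Field K]
    [Algebra F K] [IsCurveFunctionField F K] {u : K} (hu : Transcendental F u) :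
    FiniteDimensional (IntermediateField.adjoin F {u}) K := by
  have h1 : AlgebraicIndependent F (fun _ : Unit => u) :=
    algebraicIndependent_unique_type_iff.2 hu
  have h2 : IsTranscendenceBasis F (fun _ : Unit => u) :=
    h1.isTranscendenceBasis_of_lift_trdeg_le_of_finite (by
      rw [IsCurveFunctionField.trdeg_eq_one (F := F) (K := K)]; simp)
  have h3 := h2.isAlgebraic_field
  rw [show Set.range (fun _ : Unit => u) = {u} from Set.range_const] at h3
  have h4 : Algebra.EssFiniteType F K :=
    IntermediateField.fg_top_iff.1 (IsCurveFunctionField.fg (F := F) (K := K))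
  have h5 : Algebra.EssFiniteType (IntermediateField.adjoin F {u}) K :=
    Algebra.EssFiniteType.of_comp F _ _
  exact Algebra.finite_of_essFiniteType_of_isAlgebraic

/-- More elements than the degree `[K : F(u)]` satisfy a polynomial relation in `u` whose
coefficients do not all vanish at `u = 0`. -/
theorem exists_relation_of_transcendental {F K ι : Type*} [Field F] [Field K] [Algebra F K] {u : K}
    (hu : Transcendental F u) [FiniteDimensional (IntermediateField.adjoin F {u}) K] [Fintype ι]
    (hι : Module.finrank (IntermediateField.adjoin F {u}) K < Fintype.card ι) (a : ι → K) :
    ∃ p : ι → F[X], (∃ i, (p i).coeff 0 ≠ 0) ∧ ∑ i, aeval u (p i) * a i = 0 := by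
  classical
  have hdep : ¬ LinearIndependent (IntermediateField.adjoin F {u}) a := fun h =>
    absurd h.fintype_card_le_finrank (not_le.2 hι)
  obtain ⟨g, hg, i₀, hi₀⟩ := Fintype.not_linearIndependent_iff.1 hdep
  have hrep : ∀ i, ∃ r s : F[X], s ≠ 0 ∧ (g i : K) = aeval u r / aeval u s := by
    intro i
    obtain ⟨r, s, h⟩ := (IntermediateField.mem_adjoin_simple_iff F _).1 (g i).2
    -- Division by zero gives 0, so a vanishing denominator is replaced by 1 over numerator 0.
    by_cases hs : s = 0
    · exact ⟨0, 1, one_ne_zero, by rw [h, hs]; simp⟩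
    · exact ⟨r, s, hs, h⟩
  choose r s hs hrs using hrep
  have hs' : ∀ i, aeval u (s i) ≠ 0 := fun i h => hs i (transcendental_iff.1 hu _ h)
  -- If all constant coefficients vanish, the relation is divisible by u; dividing lowers the degree
  -- of a fixed nonzero coefficient, so this stops.
  have key : ∀ (N : ℕ) (p : ι → F[X]), (∃ i, p i ≠ 0 ∧ (p i).natDegree < N) →
      ∑ i, aeval u (p i) * a i = 0 →
      ∃ p : ι → F[X], (∃ i, (p i).coeff 0 ≠ 0) ∧ ∑ i, aeval u (p i) * a i = 0 := by
    intro N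
    induction N with
    | zero => rintro p ⟨i, -, h⟩; omega
    | succ N ih =>
      rintro p ⟨i, hi, hN⟩ hp
      by_cases h0 : ∃ i, (p i).coeff 0 ≠ 0
      · exact ⟨p, h0, hp⟩
      push Not at h0
      have hX : ∀ i, p i = X * (p i).divX := fun i => by
        conv_lhs => rw [← X_mul_divX_add (p i), h0 i]
        simp
      have hu0 : u ≠ 0 := by
        rintro rfl
        exact hu isAlgebraic_zero
      refine ih (fun i => (p i).divX) ⟨i, ?_, ?_⟩ ?_
      · intro h; exact hi (by rw [hX i, h, mul_zero])
      · have hd : (p i).divX ≠ 0 := fun h => hi (by rw [hX i, h, mul_zero])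
        rw [hX i, natDegree_X_mul hd] at hN
        omega
      · have : u * ∑ i, aeval u (p i).divX * a i = 0 := by
          rw [← hp, Finset.mul_sum]
          refine Finset.sum_congr rfl fun i _ => ?_
          conv_rhs => rw [hX i]
          rw [map_mul, aeval_X, mul_assoc]
        exact (mul_eq_zero.1 this).resolve_left hu0
  -- Clearing the denominators of the relation over F(u).
  let p : ι → F[X] := fun i => r i * ∏ j ∈ Finset.univ.erase i, s j
  refine key ((p i₀).natDegree + 1) p ⟨i₀, ?_, Nat.lt_succ_self _⟩ ?_
  · refine mul_ne_zero (fun h => hi₀ ?_) (Finset.prod_ne_zero_iff.2 fun j _ => hs j)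
    apply Subtype.ext
    rw [hrs, h]; simp
  · have : ∀ i, aeval u (p i) * a i = (∏ j, aeval u (s j)) * (g i • a i) := by
      intro i
      rw [← Finset.mul_prod_erase Finset.univ _ (Finset.mem_univ i), IntermediateField.smul_def,
        hrs i]
      simp only [p, map_mul, map_prod, smul_eq_mul]
      field_simp [hs' i]
    simp_rw [this, ← Finset.mul_sum, hg, mul_zero]

theorem RationalPlace.transcendental_of_val_ne_one {F K : Type*} [Field F] [Field K] [Algebra F K]
    [IsCurveFunctionField F K] (P : RationalPlace F K) {u : K} (h0 : u ≠ 0) (h1 : P.val u ≠ 1) :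
    Transcendental F u := by
  intro h
  obtain ⟨c, rfl⟩ := IsCurveFunctionField.mem_range_of_isAlgebraic (F := F) u h
  exact h1 (P.val_algebraMap c (by rintro rfl; simp at h0))

/-- If among any `r + 1` elements of `M` some nontrivial combination lies in `N`, then `M` is
covered modulo `N` by a subspace of dimension at most `r`. -/
theorem Submodule.exists_finrank_le_of_dependent {F V : Type*} [Field F] [AddCommGroup V]
    [Module F V] (M N : Submodule F V) (r : ℕ)
    (h : ∀ a : Fin (r + 1) → V, (∀ i, a i ∈ M) → ∃ c : Fin (r + 1) → F, c ≠ 0 ∧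
      ∑ i, c i • a i ∈ N) :
    ∃ G : Submodule F V, G ≤ M ∧ FiniteDimensional F G ∧ Module.finrank F G ≤ r ∧ M ≤ G ⊔ N := by
  classical
  let f : M →ₗ[F] M.map N.mkQ := N.mkQ.submoduleMap M
  have hf : Function.Surjective f := N.mkQ.submoduleMap_surjective M
  -- The image of a linear section of M → (M + N)/N serves as G.
  obtain ⟨g, hg⟩ := f.exists_rightInverse_of_surjective (LinearMap.range_eq_top.2 hf)
  have hrank : Module.rank F (M.map N.mkQ) ≤ r := by
    refine _root_.rank_le fun s hs => ?_
    by_contra hlt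
    obtain ⟨t, hts, ht⟩ := Finset.exists_subset_card_eq (show r + 1 ≤ s.card by omega)
    let e : Fin (r + 1) ≃ t := (Finset.equivFinOfCardEq ht).symm
    obtain ⟨c, hc, hcN⟩ := h (fun i => (g (e i).1 : V)) fun i => (g (e i).1).2
    have h1 : ∑ i, c i • (e i).1 = 0 := by
      have h2 : f (∑ i, c i • g (e i).1) = 0 := by
        apply Subtype.ext
        change N.mkQ ((∑ i, c i • g (e i).1 : M) : V) = 0
        rw [Submodule.mkQ_apply, Submodule.Quotient.mk_eq_zero]
        simpa using hcN
      rw [map_sum] at h2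
      rw [← h2]
      refine Finset.sum_congr rfl fun i _ => ?_
      rw [map_smul]
      exact congrArg _ (LinearMap.congr_fun hg _).symm
    have hli : LinearIndependent F (fun i => (e i).1) :=
      hs.comp (fun i => (⟨(e i).1, hts (e i).2⟩ : s)) fun i j hij => by
        simpa [Subtype.ext_iff] using hij
    exact hc (funext (Fintype.linearIndependent_iff.1 hli c h1))
  have hfin : FiniteDimensional F (M.map N.mkQ) :=
    Module.rank_lt_aleph0_iff.1 (hrank.trans_lt (Cardinal.natCast_lt_aleph0))
  refine ⟨(LinearMap.range g).map M.subtype, Submodule.map_subtype_le _ _, inferInstance, ?_, ?_⟩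
  · calc _ ≤ Module.finrank F (LinearMap.range g) := Submodule.finrank_map_le _ _
      _ ≤ Module.finrank F (M.map N.mkQ) := LinearMap.finrank_range_le _
      _ ≤ r := Module.finrank_le_of_rank_le hrank
  · intro x hx
    rw [Submodule.mem_sup]
    refine ⟨g (f ⟨x, hx⟩), ⟨g (f ⟨x, hx⟩), ⟨_, rfl⟩, rfl⟩, x - g (f ⟨x, hx⟩), ?_, by simp⟩
    rw [← Submodule.Quotient.mk_eq_zero, Submodule.Quotient.mk_sub, sub_eq_zero]
    exact (congrArg Subtype.val (LinearMap.congr_fun hg (f ⟨x, hx⟩))).symm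

section

variable {F K : Type*} [Field F] [Field K] [Algebra F K]

theorem Submodule.aeval_mul_mem (M : Submodule F K) {u : K} (hM : ∀ x ∈ M, u * x ∈ M) (p : F[X])
    {x : K} (hx : x ∈ M) : aeval u p * x ∈ M := by
  induction p using Polynomial.induction_on generalizing x with
  | C a => rw [aeval_C, ← Algebra.smul_def]; exact M.smul_mem a hx
  | add p q hp hq => rw [map_add, add_mul]; exact M.add_mem (hp hx) (hq hx)
  | monomial k a ih =>
    have : aeval u (C a * X ^ (k + 1)) * x = aeval u (C a * X ^ k) * (u * x) := by
      simp only [map_mul, aeval_C, map_pow, aeval_X]; ring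
    rw [this]; exact ih (hM x hx)

/-- If `u M ⊆ M`, then `M / u M` has dimension at most `[K : F(u)]`. -/
theorem Submodule.exists_finrank_le_sup_mul {u : K} (hu : Transcendental F u)
    [FiniteDimensional (IntermediateField.adjoin F {u}) K] (M : Submodule F K)
    (hM : ∀ x ∈ M, u * x ∈ M) :
    ∃ G : Submodule F K, G ≤ M ∧ FiniteDimensional F G ∧
      Module.finrank F G ≤ Module.finrank (IntermediateField.adjoin F {u}) K ∧
      M ≤ G ⊔ M.map (LinearMap.mulLeft F u) := by
  refine M.exists_finrank_le_of_dependent _ _ fun a ha => ?_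
  -- Reducing a relation modulo u leaves its constant coefficients, which are not all zero; the
  -- remaining terms form an element of uM.
  obtain ⟨p, ⟨i, hi⟩, hp⟩ := exists_relation_of_transcendental hu (by simp) a
  refine ⟨fun i => (p i).coeff 0, fun h => hi (congrFun h i), -∑ i, aeval u (p i).divX * a i,
    M.neg_mem (M.sum_mem fun i _ => M.aeval_mul_mem hM _ (ha i)), ?_⟩
  rw [map_neg, neg_eq_iff_add_eq_zero, ← hp, LinearMap.mulLeft_apply, Finset.mul_sum,
    ← Finset.sum_add_distrib]
  refine Finset.sum_congr rfl fun i _ => ?_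
  conv_rhs => rw [← X_mul_divX_add (p i)]
  rw [map_add, map_mul, aeval_X, aeval_C, Algebra.smul_def]
  ring

variable (F) in
/-- The elements of `K` that are regular at all places of `K / F` in the set `S`. -/
def holomorphyRing (S : Set (ValuationSubring K)) : Subalgebra F K where
  carrier := {x | ∀ V : ValuationSubring K, (∀ c : F, algebraMap F K c ∈ V) → V ∈ S → x ∈ V}
  mul_mem' hx hy V hV hne := V.mul_mem _ _ (hx V hV hne) (hy V hV hne)
  add_mem' hx hy V hV hne := V.add_mem _ _ (hx V hV hne) (hy V hV hne)
  algebraMap_mem' c _ hV _ := hV c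

theorem ValuationSubring.aeval_mem {V : ValuationSubring K} (hV : ∀ c : F, algebraMap F K c ∈ V)
    {s : K} (hs : s ∈ V) (p : F[X]) : aeval s p ∈ V := by
  rw [aeval_eq_sum_range]
  refine V.toSubring.sum_mem fun i _ => ?_
  rw [Algebra.smul_def]
  exact V.mul_mem _ _ (hV _) (V.toSubring.pow_mem hs i)

/-- Every element of `K` has a multiple by a nonzero polynomial in `s` that is regular wherever
`s` is. -/
theorem exists_aeval_mul_mem {s : K} (hs : Transcendental F s)
    [FiniteDimensional (IntermediateField.adjoin F {s}) K] (b : K) :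
    ∃ g : F[X], g ≠ 0 ∧ ∀ V : ValuationSubring K, (∀ c : F, algebraMap F K c ∈ V) → s ∈ V →
      aeval s g * b ∈ V := by
  classical
  obtain ⟨p, ⟨i, hi⟩, hp⟩ := exists_relation_of_transcendental hs
    (ι := Fin (Module.finrank (IntermediateField.adjoin F {s}) K + 1)) (by simp)
    (fun i => b ^ (i : ℕ))
  -- With m the top index of a relation ∑ p_i(s) b^i = 0, the product p_m(s) b is integral over
  -- F[s].
  obtain ⟨m, hm, hmax⟩ := (Finset.univ.filter fun i => p i ≠ 0).exists_max_image id
    ⟨i, by simp only [Finset.mem_filter, Finset.mem_univ, true_and]; rintro h; simp [h] at hi⟩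
  simp only [Finset.mem_filter, Finset.mem_univ, true_and, id] at hm hmax
  refine ⟨p m, hm, fun V hV hsV => ?_⟩
  have hgm : aeval s (p m) ≠ 0 := fun h => hm (transcendental_iff.1 hs _ h)
  by_contra hb
  have hb0 : aeval s (p m) * b ≠ 0 := fun h => hb (h ▸ V.zero_mem)
  have hb0' : b ≠ 0 := right_ne_zero_of_mul hb0
  set y := (aeval s (p m) * b)⁻¹ with hy
  have hyV : y ∈ V := (V.mem_or_inv_mem _).resolve_left hb
  have hrel : aeval s (p m) * b ^ (m : ℕ) + ∑ i ∈ Finset.univ.erase m, aeval s (p i) * b ^ (i : ℕ)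
      = 0 := by
    rw [Finset.add_sum_erase _ (fun i => aeval s (p i) * b ^ (i : ℕ)) (Finset.mem_univ m), hp]
  have hlt : ∀ i ∈ Finset.univ.erase m, p i ≠ 0 → (i : ℕ) < m := fun i hi h =>
    lt_of_le_of_ne (hmax i h) (by simpa [Fin.ext_iff] using hi)
  rcases Nat.eq_zero_or_pos (m : ℕ) with hm0 | hm0
  · rw [Finset.sum_eq_zero, hm0, pow_zero, mul_one, add_zero] at hrel
    · exact hgm hrel
    · intro i hi
      by_cases h : p i = 0
      · simp [h]
      · exact absurd (hlt i hi h) (by omega)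
  -- The relation divided by b^(m-1), with 1/b written as p_m(s) y. The truncated exponents for i >
  -- m are harmless because p_i = 0 there.
  · have h2 : aeval s (p m) * b = -∑ i ∈ Finset.univ.erase m,
        aeval s (p i) * (aeval s (p m) ^ ((m : ℕ) - 1 - i) * y ^ ((m : ℕ) - 1 - i)) := by
      have h3 : b ^ ((m : ℕ) - 1) ≠ 0 := pow_ne_zero _ hb0'
      have h4 : (m : ℕ) = (m - 1) + 1 := by omega
      apply mul_right_cancel₀ h3
      rw [mul_assoc, ← pow_succ', ← h4, eq_neg_of_add_eq_zero_left hrel, neg_mul, Finset.sum_mul]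
      congr 1
      refine Finset.sum_congr rfl fun i hi => ?_
      by_cases h : p i = 0
      · simp [h]
      · have h5 : (m : ℕ) - 1 = (m - 1 - i) + i := by have := hlt i hi h; omega
        conv_rhs => rw [h5, pow_add]
        rw [show (m : ℕ) - 1 - i + i - i = m - 1 - i by omega, ← mul_pow, hy, mul_inv,
          mul_inv_cancel_left₀ hgm, inv_pow]
        field_simp
    apply hb
    rw [h2]
    refine V.toSubring.neg_mem (V.toSubring.sum_mem fun i _ => ?_)
    exact V.mul_mem _ _ (V.aeval_mem hV hsV _) (V.mul_mem _ _
      (V.toSubring.pow_mem (V.aeval_mem hV hsV _) _) (V.toSubring.pow_mem hyV _))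

end

/-! ### Zeros of u: residue fields, centers and primes of holomorphy rings. -/

section

variable {F K : Type*} [Field F] [Field K] [Algebra F K]

/-- V is covered by G + uV with dim G ≤ [K : F(u)], and uV dies in the residue field, so G maps onto
it. The bound does not depend on V. -/
theorem ValuationSubring.card_residueField_le [Fintype F] {u : K} (hu : Transcendental F u)
    [FiniteDimensional (IntermediateField.adjoin F {u}) K] {V : ValuationSubring K}
    (hV : ∀ c : F, algebraMap F K c ∈ V) (huV : V.valuation u < 1) :
    Finite (IsLocalRing.ResidueField V) ∧ Nat.card (IsLocalRing.ResidueField V) ≤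
      Fintype.card F ^ Module.finrank (IntermediateField.adjoin F {u}) K := by
  have hu' : u ∈ V := (V.valuation_le_one_iff u).1 huV.le
  let M : Submodule F K :=
    { carrier := V
      add_mem' := fun ha hb => V.add_mem _ _ ha hb
      zero_mem' := V.zero_mem
      smul_mem' := fun c x hx => by
        rw [Algebra.smul_def]; exact V.mul_mem _ _ (hV c) hx }
  obtain ⟨G, hGM, hG, hfin, hsup⟩ := M.exists_finrank_le_sup_mul hu fun x hx => V.mul_mem _ _ hu' hx
  have : Finite G := Module.finite_of_finite F
  let f : G → IsLocalRing.ResidueField V := fun g => IsLocalRing.residue V ⟨g.1, hGM g.2⟩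
  have hf : Function.Surjective f := by
    intro z
    obtain ⟨⟨x, hx⟩, rfl⟩ := IsLocalRing.residue_surjective z
    obtain ⟨g, hg, _, ⟨y, hy, rfl⟩, h⟩ := Submodule.mem_sup.1 (hsup (show x ∈ M from hx))
    refine ⟨⟨g, hg⟩, ?_⟩
    have h1 : (⟨u, hu'⟩ : V) ∈ IsLocalRing.maximalIdeal V := (V.valuation_lt_one_iff _).2 huV
    have h2 : (⟨x, hx⟩ : V) = ⟨g, hGM hg⟩ + ⟨u, hu'⟩ * ⟨y, hy⟩ := Subtype.ext h.symm
    rw [h2, map_add, map_mul, (IsLocalRing.residue_eq_zero_iff _).2 h1, zero_mul, add_zero]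
  refine ⟨Finite.of_surjective f hf, (Nat.card_le_card_of_surjective f hf).trans ?_⟩
  rw [Nat.card_eq_fintype_card.symm.trans rfl, Module.natCard_eq_pow_finrank (K := F) (V := G),
    Nat.card_eq_fintype_card]
  exact Nat.pow_le_pow_right Fintype.card_pos hfin

/-- The order of the multiplicative group is at most C and so divides C!; a single exponent thus
serves all fields with at most C elements. -/
theorem pow_factorial_add_one_of_card_le {k : Type*} [Field k] [Finite k] {C : ℕ}
    (h : Nat.card k ≤ C) (x : k) : x ^ (C.factorial + 1) = x := by
  have := Fintype.ofFinite k
  by_cases hx : x = 0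
  · simp [hx]
  obtain ⟨m, hm⟩ : Fintype.card k - 1 ∣ C.factorial := by
    rw [Nat.card_eq_fintype_card] at h
    have := Fintype.one_lt_card (α := k)
    exact Nat.dvd_factorial (by omega) (by omega)
  rw [pow_succ, hm, pow_mul, FiniteField.pow_card_sub_one_eq_one x hx, one_pow, one_mul]

/-- An exponent `E` such that `x ^ E ≡ x` in the residue field of every place where `u` vanishes. -/
theorem exists_pow_sub_lt_one [Fintype F] {u : K} (hu : Transcendental F u)
    [FiniteDimensional (IntermediateField.adjoin F {u}) K] :
    ∃ E : ℕ, 2 ≤ E ∧ ∀ V : ValuationSubring K, (∀ c : F, algebraMap F K c ∈ V) →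
      V.valuation u < 1 → ∀ x ∈ V, V.valuation (x ^ E - x) < 1 := by
  refine ⟨_, Nat.succ_le_succ (Nat.factorial_pos
    (Fintype.card F ^ Module.finrank (IntermediateField.adjoin F {u}) K)),
    fun V hV huV x hx => ?_⟩
  obtain ⟨h1, h2⟩ := V.card_residueField_le hu hV huV
  have h3 := pow_factorial_add_one_of_card_le h2 (IsLocalRing.residue V ⟨x, hx⟩)
  rw [← sub_eq_zero, ← map_pow, ← map_sub, IsLocalRing.residue_eq_zero_iff,
    V.valuation_lt_one_iff] at h3
  exact h3

/-- Put h = x^E - x + 1. If x is regular, h reduces to 1; if x has a pole, x^E dominates. Either way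
1/h and x/h are regular, which exhibits every x in K as a quotient of elements of the holomorphy
ring. -/
theorem ValuationSubring.valuation_pow_sub_add_one {V : ValuationSubring K} {E : ℕ} (hE : 2 ≤ E)
    (h : ∀ x ∈ V, V.valuation (x ^ E - x) < 1) (x : K) :
    (x ∈ V → V.valuation (x ^ E - x + 1) = 1) ∧ x ^ E - x + 1 ≠ 0 ∧ (x ^ E - x + 1)⁻¹ ∈ V ∧
      x * (x ^ E - x + 1)⁻¹ ∈ V := by
  by_cases hx : x ∈ V
  · have h1 : V.valuation (x ^ E - x + 1) = 1 := by
      rw [Valuation.map_add_eq_of_lt_right _ (by rw [map_one]; exact h x hx), map_one]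
    have h2 : (x ^ E - x + 1)⁻¹ ∈ V := by
      rw [← V.valuation_le_one_iff, map_inv₀, h1, inv_one]
    refine ⟨fun _ => h1, fun h0 => ?_, h2, V.mul_mem _ _ hx h2⟩
    rw [h0, map_zero] at h1; exact zero_ne_one h1
  · have hx1 : 1 < V.valuation x := not_le.1 fun h => hx ((V.valuation_le_one_iff x).1 h)
    have hlt : V.valuation x < V.valuation x ^ E := lt_self_pow₀ hx1 (by omega)
    have h1 : V.valuation (x ^ E - x + 1) = V.valuation x ^ E := by
      have h2 : V.valuation (x ^ E - x) = V.valuation x ^ E := by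
        rw [Valuation.map_sub_eq_of_lt_left _ (by rwa [map_pow]), map_pow]
      rw [Valuation.map_add_eq_of_lt_left _ (by rw [h2, map_one]; exact hx1.trans hlt), h2]
    refine ⟨fun h => absurd h hx, fun h0 => ?_, ?_, ?_⟩
    · rw [h0, map_zero] at h1
      exact (zero_lt_one.trans (hx1.trans hlt)).ne h1
    · rw [← V.valuation_le_one_iff, map_inv₀, h1]
      exact inv_le_one_of_one_le₀ (hx1.trans hlt).le
    · rw [← V.valuation_le_one_iff, map_mul, map_inv₀, h1, ← div_eq_mul_inv]
      exact div_le_one_of_le₀ hlt.le zero_le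

/-- The center on a holomorphy ring of a place belonging to the defining set. -/
def ValuationSubring.center {S : Set (ValuationSubring K)} (V : ValuationSubring K)
    (hV : ∀ c : F, algebraMap F K c ∈ V) (hS : V ∈ S) : Ideal (holomorphyRing F S) :=
  (IsLocalRing.maximalIdeal V).comap
    (((holomorphyRing F S).val : holomorphyRing F S →+* K).codRestrict V.toSubring
      fun x => x.2 V hV hS)

instance {S : Set (ValuationSubring K)} (V : ValuationSubring K)
    (hV : ∀ c : F, algebraMap F K c ∈ V) (hS : V ∈ S) : (V.center hV hS).IsPrime :=
  Ideal.comap_isPrime _ _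

theorem ValuationSubring.mem_center {S : Set (ValuationSubring K)} {V : ValuationSubring K}
    {hV : ∀ c : F, algebraMap F K c ∈ V} {hS : V ∈ S} {x : holomorphyRing F S} :
    x ∈ V.center hV hS ↔ V.valuation (x : K) < 1 :=
  V.valuation_lt_one_iff _

/-- A place is recovered from its center. For x in V the element 1/h, with h = x^E - x + 1, is a
unit at V, so it lies outside the common center and is a unit at W too; then x = (x/h) h lies in W.
-/
theorem ValuationSubring.le_of_center_eq {S : Set (ValuationSubring K)} {E : ℕ} (hE : 2 ≤ E)
    (hS : ∀ V : ValuationSubring K, (∀ c : F, algebraMap F K c ∈ V) → V ∈ S →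
      ∀ x ∈ V, V.valuation (x ^ E - x) < 1)
    {V W : ValuationSubring K} {hV : ∀ c : F, algebraMap F K c ∈ V} {hVS : V ∈ S}
    {hW : ∀ c : F, algebraMap F K c ∈ W} {hWS : W ∈ S} (h : V.center hV hVS = W.center hW hWS) :
    V ≤ W := by
  intro x hx
  let a : holomorphyRing F S := ⟨(x ^ E - x + 1)⁻¹, fun U hU hUS =>
    (ValuationSubring.valuation_pow_sub_add_one hE (hS U hU hUS) x).2.2.1⟩
  obtain ⟨h1, h2, -, -⟩ := ValuationSubring.valuation_pow_sub_add_one hE (hS V hV hVS) x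
  obtain ⟨-, -, h3, h4⟩ := ValuationSubring.valuation_pow_sub_add_one hE (hS W hW hWS) x
  have ha : a ∉ W.center hW hWS := by
    rw [← h, ValuationSubring.mem_center]
    change ¬ V.valuation (x ^ E - x + 1)⁻¹ < 1
    rw [map_inv₀, h1 hx, inv_one]
    exact lt_irrefl _
  rw [ValuationSubring.mem_center, not_lt] at ha
  change 1 ≤ W.valuation (x ^ E - x + 1)⁻¹ at ha
  have h5 : x ^ E - x + 1 ∈ W := by
    rw [← W.valuation_le_one_iff]
    rw [map_inv₀] at ha
    have := inv_le_one_of_one_le₀ ha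
    rwa [inv_inv] at this
  have := W.mul_mem _ _ h4 h5
  rwa [mul_assoc, inv_mul_cancel₀ h2, mul_one] at this

/-- Only finitely many primes of a holomorphy ring contain a given transcendental element. -/
theorem finite_primes_holomorphyRing [Fintype F] {S : Set (ValuationSubring K)}
    (u : holomorphyRing F S) (hu : Transcendental F (u : K))
    [FiniteDimensional (IntermediateField.adjoin F {(u : K)}) K] :
    {p : Ideal (holomorphyRing F S) | p.IsPrime ∧ u ∈ p}.Finite := by
  obtain ⟨G, hGM, hG, -, hsup⟩ :=
    (Subalgebra.toSubmodule (holomorphyRing F S)).exists_finrank_le_sup_mul hu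
      fun x hx => (holomorphyRing F S).mul_mem u.2 hx
  have : Finite G := Module.finite_of_finite F
  -- Since the ring is covered by G + u times itself, a prime containing u is determined by its
  -- trace on the finite set G.
  refine Set.Finite.of_finite_image
    (f := fun p => {g : G | (⟨g.1, hGM g.2⟩ : holomorphyRing F S) ∈ p}) (Set.toFinite _) ?_
  have key : ∀ p q : Ideal (holomorphyRing F S), u ∈ p → u ∈ q →
      {g : G | (⟨g.1, hGM g.2⟩ : holomorphyRing F S) ∈ p} =
        {g : G | (⟨g.1, hGM g.2⟩ : holomorphyRing F S) ∈ q} → p ≤ q := by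
    intro p q hp hq hpq x hx
    obtain ⟨g, hg, _, ⟨y, hy, rfl⟩, h⟩ := Submodule.mem_sup.1 (hsup x.2)
    have h2 : x = (⟨g, hGM hg⟩ : holomorphyRing F S) + u * ⟨y, hy⟩ := Subtype.ext h.symm
    have h3 : (⟨g, hGM hg⟩ : holomorphyRing F S) ∈ p :=
      (Ideal.add_mem_iff_left _ (p.mul_mem_right _ hp)).1 (h2 ▸ hx)
    have h4 : (⟨g, hg⟩ : G) ∈ {g : G | (⟨g.1, hGM g.2⟩ : holomorphyRing F S) ∈ q} := by
      rw [← hpq]; exact h3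
    rw [h2]
    exact q.add_mem h4 (q.mul_mem_right _ hq)
  intro p hp q hq hpq
  exact le_antisymm (key p q hp.2 hq.2 hpq) (key q p hq.2 hp.2 hpq.symm)

end

/-! ### Separating ∞ from the other zeros of u. -/

namespace RationalPlace

section

variable {F K : Type*} [Field F] [Field K] [Algebra F K] (P : RationalPlace F K)

theorem valuationSubring_valuation_lt_one_iff (x : K) :
    P.val.valuationSubring.valuation x < 1 ↔ P.val x < 1 :=
  (Valuation.isEquiv_valuation_valuationSubring P.val).symm.lt_one_iff_lt_one

theorem val_algebraMap_le (c : F) : P.val (algebraMap F K c) ≤ 1 := by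
  by_cases hc : c = 0
  · simp [hc]
  · exact (P.val_algebraMap c hc).le

theorem val_aeval_le {u : K} (hu : P.val u ≤ 1) (p : F[X]) : P.val (aeval u p) ≤ 1 :=
  ValuationSubring.aeval_mem (V := P.val.valuationSubring) P.val_algebraMap_le hu p

theorem val_aeval_eq_one {u : K} (hu : P.val u < 1) {p : F[X]} (hp : p.coeff 0 ≠ 0) :
    P.val (aeval u p) = 1 := by
  rw [← X_mul_divX_add p, map_add, map_mul, aeval_X, aeval_C,
    Valuation.map_add_eq_of_lt_right, P.val_algebraMap _ hp]
  rw [P.val_algebraMap _ hp, map_mul]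
  exact mul_lt_one_of_nonneg_of_lt_one_left zero_le hu (P.val_aeval_le hu.le _)

/-- There is an element with a pole at `∞` that is regular at every other zero of `u`. -/
theorem exists_one_lt_val_of_holomorphyRing [Fintype F] {u : K} (hu : Transcendental F u)
    [FiniteDimensional (IntermediateField.adjoin F {u}) K] (hu1 : P.val u < 1) :
    ∃ w ∈ holomorphyRing F {V | u⁻¹ ∉ V ∧ V ≠ P.val.valuationSubring}, 1 < P.val w := by
  classical
  have hu0 : u ≠ 0 := by rintro rfl; exact hu isAlgebraic_zero
  let S : Set (ValuationSubring K) := {V | u⁻¹ ∉ V}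
  have huV : ∀ V ∈ S, V.valuation u < 1 := by
    intro V hV
    have := mt (V.valuation_le_one_iff u⁻¹).1 hV
    rw [map_inv₀, not_le] at this
    have h := inv_lt_one_of_one_lt₀ this
    rwa [inv_inv] at h
  obtain ⟨E, hE, hES⟩ := exists_pow_sub_lt_one hu
  have hS : ∀ V : ValuationSubring K, (∀ c : F, algebraMap F K c ∈ V) → V ∈ S →
      ∀ x ∈ V, V.valuation (x ^ E - x) < 1 := fun V hV hVS => hES V hV (huV V hVS)
  have hI : P.val.valuationSubring ∈ S := by
    intro h
    have h' : P.val u⁻¹ ≤ 1 := h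
    rw [map_inv₀] at h'
    have h0 : 0 < P.val u := zero_lt_iff.2 ((P.val.ne_zero_iff).2 hu0)
    exact absurd ((inv_le_one₀ h0).1 h') (not_le.2 hu1)
  have hFI : ∀ c : F, algebraMap F K c ∈ P.val.valuationSubring := P.val_algebraMap_le
  let u' : holomorphyRing F S := ⟨u, fun V _ hVS => (V.valuation_le_one_iff u).1 (huV V hVS).le⟩
  let p := P.val.valuationSubring.center hFI hI
  have hpm : ∀ x : holomorphyRing F S, x ∈ p ↔ P.val (x : K) < 1 := fun x =>
    ValuationSubring.mem_center.trans (P.valuationSubring_valuation_lt_one_iff _)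
  have hT := finite_primes_holomorphyRing u' hu
  -- The center of ∞ is maximal because the residue field at ∞ is F.
  have hmax : ∀ r : Ideal (holomorphyRing F S), r.IsPrime → p ≤ r → r = p := by
    intro r hr hle
    refine le_antisymm (fun x hx => ?_) hle
    by_contra hxp
    obtain ⟨c, hc⟩ := P.exists_residue x (x.2 _ hFI hI)
    have h1 : x - algebraMap F _ c ∈ p := (hpm _).2 hc
    have h2 : algebraMap F (holomorphyRing F S) c ∈ r := by
      have := r.sub_mem hx (hle h1)
      rwa [sub_sub_cancel] at this
    by_cases hc0 : c = 0
    · rw [hc0, map_zero, sub_zero] at h1; exact hxp h1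
    · exact hr.ne_top (r.eq_top_of_isUnit_mem h2 ((isUnit_iff_ne_zero.2 hc0).map _))
  -- Prime avoidance among the finitely many primes containing u; the inverse of y is the desired
  -- function, since distinct zeros of u have distinct centers.
  obtain ⟨y, hyp, hy0, hy⟩ : ∃ y ∈ p, y ≠ 0 ∧ ∀ r : Ideal (holomorphyRing F S), r.IsPrime →
      u' ∈ r → r ≠ p → y ∉ r := by
    have hav : ¬ ((p : Set (holomorphyRing F S)) ⊆
        ⋃ i ∈ ((hT.toFinset.erase p : Finset (Ideal (holomorphyRing F S))) :
          Set (Ideal (holomorphyRing F S))), i) := by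
      rw [Ideal.subset_union_prime p p]
      · rintro ⟨r, hr, hle⟩
        rw [Finset.mem_erase, Set.Finite.mem_toFinset] at hr
        exact hr.1 (hmax r hr.2.1 hle)
      · intro r hr _ _
        rw [Finset.mem_erase, Set.Finite.mem_toFinset] at hr
        exact hr.2.1
    obtain ⟨y, hyp, hy⟩ := Set.not_subset.1 hav
    have hy' : ∀ r : Ideal (holomorphyRing F S), r.IsPrime → u' ∈ r → r ≠ p → y ∉ r :=
      fun r hr hur hrp hyr => hy (Set.mem_biUnion (x := r) (by simp [hrp, hr, hur]) hyr)
    -- If y = 0 avoids every other prime containing u, there is no such prime, and u itself can be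
    -- used.
    by_cases hy0 : y = 0
    · exact ⟨u', (hpm _).2 hu1, fun h => hu0 (congrArg Subtype.val h), fun r hr hur hrp _ =>
        hy' r hr hur hrp (hy0 ▸ r.zero_mem)⟩
    · exact ⟨y, hyp, hy0, hy'⟩
  have hy0' : (y : K) ≠ 0 := fun h => hy0 (Subtype.ext h)
  refine ⟨(y : K)⁻¹, fun V hV hVS => ?_, ?_⟩
  · have h1 : V.center hV hVS.1 ≠ p := fun h => hVS.2
      (le_antisymm (ValuationSubring.le_of_center_eq hE hS h)
        (ValuationSubring.le_of_center_eq hE hS h.symm))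
    have h2 := hy _ inferInstance (ValuationSubring.mem_center.2 (huV V hVS.1)) h1
    rw [ValuationSubring.mem_center, not_lt] at h2
    rw [← V.valuation_le_one_iff, map_inv₀]
    exact inv_le_one_of_one_le₀ h2
  · rw [map_inv₀]
    exact (one_lt_inv₀ (zero_lt_iff.2 ((P.val.ne_zero_iff).2 hy0'))).2 ((hpm y).1 hyp)

/-- Removing the place `∞` from the zeros of `u` makes the fibre of `u` have dimension
strictly less than `[K : F(u)]`. -/
theorem exists_finrank_lt_sup_mul [Fintype F] {u : K} (hu : Transcendental F u)
    [FiniteDimensional (IntermediateField.adjoin F {u}) K] (hu1 : P.val u < 1) :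
    ∃ G : Submodule F K, FiniteDimensional F G ∧
      Module.finrank F G + 1 ≤ Module.finrank (IntermediateField.adjoin F {u}) K ∧
      ∀ x ∈ holomorphyRing F {V | u⁻¹ ∉ V ∧ V ≠ P.val.valuationSubring},
        ∃ g ∈ G, ∃ y ∈ holomorphyRing F {V | u⁻¹ ∉ V ∧ V ≠ P.val.valuationSubring},
          x = g + u * y := by
  classical
  set O := holomorphyRing F {V | u⁻¹ ∉ V ∧ V ≠ P.val.valuationSubring} with hO
  obtain ⟨w, hwO, hw⟩ := P.exists_one_lt_val_of_holomorphyRing hu hu1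
  have huO : u ∈ O := fun V _ hVS => (V.mem_or_inv_mem u).resolve_right hVS.1
  obtain ⟨r, hr⟩ : ∃ r, Module.finrank (IntermediateField.adjoin F {u}) K = r + 1 :=
    Nat.exists_eq_succ_of_ne_zero Module.finrank_pos.ne'
  obtain ⟨G, -, h1, h2, h3⟩ := (Subalgebra.toSubmodule O).exists_finrank_le_of_dependent
    ((Subalgebra.toSubmodule O).map (LinearMap.mulLeft F u)) r (by
      intro a ha
      -- An auxiliary element w^k with a pole at ∞ larger than those of all a_i brings the family to
      -- n + 1 elements, which forces a relation.
      obtain ⟨k, hk⟩ : ∃ k : ℕ, ∀ i, P.val (a i) < P.val (w ^ k) := by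
        choose k hk using fun i => MulArchimedean.arch (P.val (a i)) hw
        refine ⟨(Finset.univ.sup k) + 1, fun i => ?_⟩
        rw [map_pow]
        exact (hk i).trans_lt (pow_lt_pow_right₀ hw
          (Nat.lt_succ_of_le (Finset.le_sup (Finset.mem_univ i))))
      obtain ⟨p, hp0, hp⟩ := exists_relation_of_transcendental hu (ι := Option (Fin (r + 1)))
        (by simp [hr]) (fun i => i.elim (w ^ k) a)
      rw [Fintype.sum_option] at hp
      simp only [Option.elim] at hp
      -- Otherwise the term of w^k would strictly dominate all others at ∞. The nonzero constant
      -- coefficient therefore belongs to one of the a_i.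
      have hn : (p none).coeff 0 = 0 := by
        by_contra hne
        have h1 : P.val (∑ i, aeval u (p (some i)) * a i) < P.val (w ^ k) := by
          refine P.val.map_sum_lt ?_ fun i _ => ?_
          · rw [map_pow]; exact pow_ne_zero _ (zero_lt_one.trans hw).ne'
          · rw [map_mul]
            exact (mul_le_of_le_one_left' (P.val_aeval_le hu1.le _)).trans_lt (hk i)
        rw [← neg_eq_of_add_eq_zero_right hp, Valuation.map_neg, map_mul,
          P.val_aeval_eq_one hu1 hne, one_mul] at h1
        exact lt_irrefl _ h1
      refine ⟨fun i => (p (some i)).coeff 0, fun h => ?_, -(aeval u (p none).divX * w ^ k +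
        ∑ i, aeval u (p (some i)).divX * a i), ?_, ?_⟩
      · obtain ⟨i, hi⟩ := hp0
        cases i with
        | none => exact hi hn
        | some i => exact hi (congrFun h i)
      · have hM : ∀ x ∈ Subalgebra.toSubmodule O, u * x ∈ Subalgebra.toSubmodule O :=
          fun x hx => O.mul_mem huO hx
        exact Submodule.neg_mem _ (Submodule.add_mem _
          (Submodule.aeval_mul_mem _ hM _ (O.pow_mem hwO k))
          (Submodule.sum_mem _ fun i _ => Submodule.aeval_mul_mem _ hM _ (ha i)))
      · rw [map_neg, neg_eq_iff_add_eq_zero, ← hp, LinearMap.mulLeft_apply, mul_add,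
          Finset.mul_sum, add_assoc, ← Finset.sum_add_distrib]
        congr 1
        · conv_rhs => rw [← X_mul_divX_add (p none), hn]
          simp only [map_mul, aeval_X, map_zero, add_zero, mul_assoc]
        · refine Finset.sum_congr rfl fun i _ => ?_
          conv_rhs => rw [← X_mul_divX_add (p (some i))]
          rw [map_add, map_mul, aeval_X, aeval_C, Algebra.smul_def]
          ring)
  refine ⟨G, h1, by omega, fun x hx => ?_⟩
  obtain ⟨g, hg, _, ⟨y, hy, rfl⟩, h⟩ := Submodule.mem_sup.1 (h3 hx)
  exact ⟨g, hg, y, hy, h.symm⟩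

end

end RationalPlace

/-! ### Existence of a nonconstant element of A by counting dimensions. -/

section

variable {F K : Type*} [Field F] [Field K] [Algebra F K]

/-- At a zero of u, a polynomial in u with nonzero constant term is a unit. -/
theorem ValuationSubring.mem_of_aeval_mul_mem {V : ValuationSubring K}
    (hV : ∀ c : F, algebraMap F K c ∈ V) {u : K} (hu : V.valuation u < 1) {p : F[X]}
    (hp : p.coeff 0 ≠ 0) {x : K} (hx : aeval u p * x ∈ V) : x ∈ V := by
  have h1 : V.valuation (algebraMap F K (p.coeff 0)) = 1 := by
    have h := (V.valuation_le_one_iff _).2 (hV (p.coeff 0)⁻¹)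
    rw [map_inv₀, map_inv₀] at h
    have h0 : 0 < V.valuation (algebraMap F K (p.coeff 0)) :=
      zero_lt_iff.2 ((V.valuation.ne_zero_iff).2 (by simpa using hp))
    exact le_antisymm ((V.valuation_le_one_iff _).2 (hV _)) ((inv_le_one₀ h0).1 h)
  have h2 : V.valuation (aeval u p) = 1 := by
    rw [← X_mul_divX_add p, map_add, map_mul, aeval_X, aeval_C,
      Valuation.map_add_eq_of_lt_right, h1]
    rw [h1, map_mul]
    exact mul_lt_one_of_nonneg_of_lt_one_left zero_le hu
      ((V.valuation_le_one_iff _).2 (V.aeval_mem hV ((V.valuation_le_one_iff u).1 hu.le) _))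
  rwa [← V.valuation_le_one_iff, map_mul, h2, one_mul, V.valuation_le_one_iff] at hx

theorem ValuationSubring.valuation_lt_one_of_inv_notMem {V : ValuationSubring K} {u : K}
    (h : u⁻¹ ∉ V) : V.valuation u < 1 := by
  have := mt (V.valuation_le_one_iff u⁻¹).1 h
  rw [map_inv₀, not_le] at this
  have h := inv_lt_one_of_one_lt₀ this
  rwa [inv_inv] at h

/-- H is the sum of the spaces u^(-j) G for 1 ≤ j ≤ k: polar parts of order at most k in u cost at
most dim G each. -/
theorem Submodule.exists_finrank_le_pow_mul {u : K} (hu : u ≠ 0) (O G : Submodule F K)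
    [FiniteDimensional F G] (h : ∀ x ∈ O, ∃ g ∈ G, ∃ y ∈ O, x = g + u * y) (k : ℕ) :
    ∃ H : Submodule F K, FiniteDimensional F H ∧ Module.finrank F H ≤ k * Module.finrank F G ∧
      ∀ x ∈ O, ∃ g ∈ H, ∃ y ∈ O, u⁻¹ ^ k * x = g + y := by
  induction k with
  | zero =>
    exact ⟨⊥, inferInstance, by simp, fun x hx => ⟨0, Submodule.zero_mem _, x, hx, by simp⟩⟩
  | succ k ih =>
    obtain ⟨H, hH, hle, hmem⟩ := ih
    refine ⟨H ⊔ G.map (LinearMap.mulLeft F (u⁻¹ ^ (k + 1))), inferInstance, ?_, fun x hx => ?_⟩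
    · have h1 := Submodule.finrank_add_le_finrank_add_finrank H
        (G.map (LinearMap.mulLeft F (u⁻¹ ^ (k + 1))))
      have h2 := Submodule.finrank_map_le (LinearMap.mulLeft F (u⁻¹ ^ (k + 1))) G
      rw [add_mul, one_mul]; omega
    · obtain ⟨g, hg, y, hy, rfl⟩ := h x hx
      obtain ⟨g', hg', y', hy', h'⟩ := hmem y hy
      refine ⟨g' + u⁻¹ ^ (k + 1) * g, Submodule.add_mem_sup hg' ⟨g, hg, rfl⟩, y', hy', ?_⟩
      rw [mul_add, pow_succ, mul_assoc, mul_assoc, inv_mul_cancel_left₀ hu, h']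
      ring

/-- Any basis over F(u) can be scaled by polynomials in 1/u to become regular where 1/u is. At a
zero of u, a multiplier p(u) that clears poles may be replaced by the power of u that it contains,
its cofactor being a unit; c is the largest such power. -/
theorem exists_basis_regular {u : K} (hu : Transcendental F u)
    [FiniteDimensional (IntermediateField.adjoin F {u}) K]
    [FiniteDimensional (IntermediateField.adjoin F {u⁻¹}) K] :
    ∃ b : Fin (Module.finrank (IntermediateField.adjoin F {u}) K) → K,
      LinearIndependent (IntermediateField.adjoin F {u}) b ∧
      (∀ i, ∀ V : ValuationSubring K, (∀ c : F, algebraMap F K c ∈ V) → u⁻¹ ∈ V → b i ∈ V) ∧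
      ∃ c : ℕ, ∀ i, ∀ V : ValuationSubring K, (∀ c : F, algebraMap F K c ∈ V) → u⁻¹ ∉ V →
        u ^ c * b i ∈ V := by
  have hu' : Transcendental F u⁻¹ := fun h => hu (by simpa using h.inv)
  let b₀ := Module.finBasis (IntermediateField.adjoin F {u}) K
  choose g hg0 hg using fun i => exists_aeval_mul_mem hu' (b₀ i)
  have hli : LinearIndependent (IntermediateField.adjoin F {u}) fun i => aeval u⁻¹ (g i) * b₀ i := by
    have hmem : ∀ i, aeval u⁻¹ (g i) ∈ IntermediateField.adjoin F {u} := fun i =>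
      Algebra.adjoin_le (S := (IntermediateField.adjoin F {u}).toSubalgebra)
        (Set.singleton_subset_iff.2 ((IntermediateField.adjoin F {u}).inv_mem
          (IntermediateField.mem_adjoin_simple_self F u)))
        (aeval_mem_adjoin_singleton F _)
    have h := b₀.linearIndependent.units_smul fun i =>
      Units.mk0 (⟨aeval u⁻¹ (g i), hmem i⟩ : IntermediateField.adjoin F {u})
        fun h => hg0 i (transcendental_iff.1 hu' _ (congrArg Subtype.val h))
    exact h
  choose p hp0 hp using fun i => exists_aeval_mul_mem hu (aeval u⁻¹ (g i) * b₀ i)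
  refine ⟨_, hli, hg, Finset.univ.sup fun i => (p i).natTrailingDegree, fun i V hV hVu => ?_⟩
  have hVu' := ValuationSubring.valuation_lt_one_of_inv_notMem hVu
  have huV : u ∈ V := (V.valuation_le_one_iff u).1 hVu'.le
  obtain ⟨q, hq⟩ := X_pow_dvd_iff.2 fun d (hd : d < (p i).natTrailingDegree) =>
    coeff_eq_zero_of_lt_natTrailingDegree hd
  have hq0 : q.coeff 0 ≠ 0 := by
    have h1 : (p i).coeff (p i).natTrailingDegree ≠ 0 := by
      rw [← trailingCoeff]; simpa using hp0 i
    intro h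
    conv at h1 => enter [1, 1]; rw [hq]
    exact h1 (by rw [coeff_X_pow_mul' ]; simpa using h)
  have h1 : u ^ (p i).natTrailingDegree * (aeval u⁻¹ (g i) * b₀ i) ∈ V := by
    refine ValuationSubring.mem_of_aeval_mul_mem hV hVu' hq0 ?_
    have h2 := hp i V hV huV
    conv at h2 => enter [2, 1]; rw [hq]
    rw [map_mul, map_pow, aeval_X] at h2
    rwa [← mul_assoc, mul_comm (aeval u q)]
  obtain ⟨e, he⟩ := Nat.exists_eq_add_of_le
    (Finset.le_sup (f := fun i => (p i).natTrailingDegree) (Finset.mem_univ i))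
  rw [he, add_comm, pow_add, mul_assoc]
  exact V.mul_mem _ _ (V.toSubring.pow_mem huV _) h1

end

namespace RationalPlace

variable {F K : Type*} [Field F] [Field K] [Algebra F K]

/-- The base ring contains an element with a pole at `∞`. -/
theorem exists_mem_baseRing_one_lt_val [Fintype F] [IsCurveFunctionField F K]
    (P : RationalPlace F K) : ∃ x ∈ P.baseRing, 1 < P.val x := by
  classical
  obtain ⟨u, huv⟩ := P.val_surjective (WithZero.exp (-1))
  have hu1 : P.val u < 1 := by
    rw [huv, ← WithZero.exp_zero, WithZero.exp_lt_exp]; omega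
  have hu0 : u ≠ 0 := by rintro rfl; rw [map_zero] at huv; exact WithZero.exp_ne_zero huv.symm
  have hu : Transcendental F u := P.transcendental_of_val_ne_one hu0 hu1.ne
  have hu' : Transcendental F u⁻¹ := fun h => hu (by simpa using h.inv)
  have := IsCurveFunctionField.finiteDimensional_adjoin hu
  have := IsCurveFunctionField.finiteDimensional_adjoin hu'
  let n := Module.finrank (IntermediateField.adjoin F {u}) K
  obtain ⟨b, hli, hbB, c, hbO⟩ := exists_basis_regular hu
  obtain ⟨G, hG, hGr, hGO⟩ := P.exists_finrank_lt_sup_mul hu hu1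
  set O := holomorphyRing F {V | u⁻¹ ∉ V ∧ V ≠ P.val.valuationSubring} with hO
  by_contra! hcon
  -- With g = dim G ≤ n - 1, the count at the end reads nN ≤ (N + c) g + 1, so N ≤ cg + 1; this N is
  -- the first to contradict it.
  let N := c * Module.finrank F G + 2
  obtain ⟨H, hH, hHr, hHO⟩ := (Subalgebra.toSubmodule O).exists_finrank_le_pow_mul hu0 G hGO (N + c)
  let Λ : (Fin n → degreeLT F N) →ₗ[F] K :=
    ∑ i, (LinearMap.mulRight F (b i)) ∘ₗ (aeval u⁻¹).toLinearMap ∘ₗ (degreeLT F N).subtype ∘ₗ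
      LinearMap.proj i
  have hΛ : ∀ p, Λ p = ∑ i, aeval u⁻¹ (p i : F[X]) * b i := fun p => by
    simp only [Λ, LinearMap.sum_apply]; rfl
  have hinj : Function.Injective Λ := by
    rw [← LinearMap.ker_eq_bot, LinearMap.ker_eq_bot']
    intro p hp
    rw [hΛ] at hp
    have hmem : ∀ i, aeval u⁻¹ (p i : F[X]) ∈ IntermediateField.adjoin F {u} := fun i =>
      Algebra.adjoin_le (S := (IntermediateField.adjoin F {u}).toSubalgebra)
        (Set.singleton_subset_iff.2 ((IntermediateField.adjoin F {u}).inv_mem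
          (IntermediateField.mem_adjoin_simple_self F u)))
        (aeval_mem_adjoin_singleton F _)
    have h := Fintype.linearIndependent_iff.1 hli (fun i => ⟨_, hmem i⟩) hp
    funext i
    exact Subtype.ext (transcendental_iff.1 hu' _ (congrArg Subtype.val (h i)))
  have hB : ∀ p, ∀ V : ValuationSubring K, (∀ c : F, algebraMap F K c ∈ V) → u⁻¹ ∈ V →
      Λ p ∈ V := by
    intro p V hV huV
    rw [hΛ]
    exact V.toSubring.sum_mem fun i _ => V.mul_mem _ _ (V.aeval_mem hV huV _) (hbB i V hV huV)
  have hΛO : ∀ p, u ^ (N + c) * Λ p ∈ O := by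
    intro p V hV hVS
    have huV : u ∈ V := (V.mem_or_inv_mem u).resolve_right hVS.1
    rw [hΛ, Finset.mul_sum]
    refine V.toSubring.sum_mem fun i _ => ?_
    have h1 : u ^ N * aeval u⁻¹ (p i : F[X]) ∈ V := by
      have hdeg := mem_degreeLT.1 (p i).2
      have hdeg' : (p i : F[X]).natDegree < N := by
        by_cases h0 : (p i : F[X]) = 0
        · rw [h0, natDegree_zero]; omega
        · exact (natDegree_lt_iff_degree_lt h0).2 hdeg
      rw [aeval_eq_sum_range' hdeg', Finset.mul_sum]
      refine V.toSubring.sum_mem fun j hj => ?_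
      have hj' : N = (N - j) + j := by have := Finset.mem_range.1 hj; omega
      rw [Algebra.smul_def, mul_left_comm]
      refine V.mul_mem _ _ (hV _) ?_
      conv => enter [2, 1]; rw [hj', pow_add]
      rw [mul_assoc, ← mul_pow, mul_inv_cancel₀ hu0, one_pow, mul_one]
      exact V.toSubring.pow_mem huV _
    have h2 : u ^ (N + c) * (aeval u⁻¹ (p i : F[X]) * b i) =
        u ^ N * aeval u⁻¹ (p i : F[X]) * (u ^ c * b i) := by ring
    rw [h2]
    exact V.mul_mem _ _ h1 (hbO i V hV hVS.1)
  -- Elements of the kernel have no pole outside ∞, hence lie in A; under the contrary assumption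
  -- they are constants.
  let Ψ := (Subalgebra.toSubmodule O).mkQ ∘ₗ Λ
  have hrange : Module.finrank F (LinearMap.range Ψ) ≤ (N + c) * Module.finrank F G := by
    refine (Submodule.finrank_mono (t := H.map (Subalgebra.toSubmodule O).mkQ) ?_).trans
      ((Submodule.finrank_map_le _ _).trans hHr)
    rintro _ ⟨p, rfl⟩
    obtain ⟨g, hg, y, hy, h⟩ := hHO _ (hΛO p)
    rw [← mul_assoc, ← mul_pow, inv_mul_cancel₀ hu0, one_pow, one_mul] at h
    refine ⟨g, hg, ?_⟩
    change _ = (Subalgebra.toSubmodule O).mkQ (Λ p)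
    rw [h, map_add, left_eq_add, Submodule.mkQ_apply, Submodule.Quotient.mk_eq_zero]
    exact hy
  have hker : Module.finrank F (LinearMap.ker Ψ) ≤ 1 := by
    have h1 : (LinearMap.ker Ψ).map Λ ≤ Submodule.span F {(1 : K)} := by
      rintro _ ⟨p, hp, rfl⟩
      have hpO : Λ p ∈ O := by
        have h : (Subalgebra.toSubmodule O).mkQ (Λ p) = 0 := hp
        rwa [Submodule.mkQ_apply, Submodule.Quotient.mk_eq_zero] at h
      have hpA : ∀ a : F, Λ p - algebraMap F K a ∈ P.baseRing := fun a =>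
        P.baseRing.sub_mem (fun V hV hne => by
          by_cases h : u⁻¹ ∈ V
          · exact hB p V hV h
          · exact hpO V hV ⟨h, hne⟩) (P.baseRing.algebraMap_mem a)
      obtain ⟨a, ha⟩ := P.exists_residue (Λ p)
        (hcon _ (by simpa using hpA 0))
      rw [Submodule.mem_span_singleton]
      refine ⟨a, ?_⟩
      rw [← Algebra.algebraMap_eq_smul_one]
      by_contra hne
      exact ha.ne (P.val_eq_one_of_le_one (hpA a) (sub_ne_zero.2 (Ne.symm hne)) ha.le)
    rw [(Submodule.equivMapOfInjective Λ hinj _).finrank_eq]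
    exact (Submodule.finrank_mono h1).trans (finrank_span_singleton one_ne_zero).le
  have hrk := LinearMap.finrank_range_add_finrank_ker Ψ
  have hD : Module.finrank F (Fin n → degreeLT F N) = n * N := by
    rw [Module.finrank_pi_fintype, (degreeLTEquiv F N).finrank_eq]
    simp
  rw [hD] at hrk
  have h1 : (Module.finrank F G + 1) * N ≤ n * N := Nat.mul_le_mul_right _ hGr
  have h2 : N = c * Module.finrank F G + 2 := rfl
  clear_value N
  nlinarith

end RationalPlace

/-! ### Power sums and q-polynomials on finite F-subspaces. -/

section

variable {F L U : Type*} [Field F] [Fintype F] [Field L] [Algebra F L] [AddCommGroup U]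
  [Module F U] [Fintype U]

/-- Power sums over a translate of a finite `F`-subspace vanish for small exponents. -/
theorem sum_add_pow_eq_zero {e : U →ₗ[F] L} (he : Function.Injective e) {n : ℕ}
    (hn : (n + 1) * Fintype.card F ≤ Fintype.card U) (η : L) : ∑ u, (η + e u) ^ n = 0 := by
  classical
  have hq := Fintype.one_lt_card (α := F)
  have hnt : Nontrivial U := Fintype.one_lt_card_iff_nontrivial.1 (by nlinarith)
  obtain ⟨w, hw⟩ := exists_ne (0 : U)
  obtain ⟨U', hU'⟩ := Submodule.exists_isCompl (Submodule.span F {w})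
  let E : (F × U') ≃ₗ[F] U := ((LinearEquiv.toSpanNonzeroSingleton F U w hw).prodCongr
    (LinearEquiv.refl F U')).trans (Submodule.prodEquivOfIsCompl _ _ hU')
  have hE : ∀ x, E x = x.1 • w + x.2 := fun x => rfl
  have hcard : n < Fintype.card U' := by
    have h := Fintype.card_congr E.toEquiv
    rw [Fintype.card_prod] at h
    rw [← h, mul_comm] at hn
    exact Nat.le_of_mul_le_mul_left hn (by omega)
  -- On a hyperplane U' this polynomial is invariant under translation by U' and has degree below
  -- the size of U', so it is constant. The q cosets of U' then contribute equally, and q = 0 in L.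
  let h : L[X] := ∑ u : U', (X + C (e u)) ^ n
  have hdeg : (h - C (h.eval 0)).natDegree < Fintype.card U' := by
    refine lt_of_le_of_lt ?_ hcard
    rw [natDegree_sub_C]
    refine natDegree_sum_le_of_forall_le _ _ fun u _ => ?_
    rw [natDegree_pow, natDegree_X_add_C, mul_one]
  have hconst : h = C (h.eval 0) := by
    rw [← sub_eq_zero]
    refine eq_zero_of_natDegree_lt_card_of_eval_eq_zero _ (f := fun u : U' => e u)
      (fun u v huv => Subtype.ext (he huv)) (fun v => ?_) hdeg
    simp only [h, eval_sub, eval_C, eval_finsetSum, eval_pow, eval_add, eval_X, sub_eq_zero,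
      zero_add, ← map_add]
    exact Fintype.sum_equiv (Equiv.addLeft v) _ _ fun u => by simp
  rw [← E.toEquiv.sum_comp, Fintype.sum_prod_type]
  have : ∀ c : F, ∑ u : U', (η + e (E.toEquiv (c, u))) ^ n = h.eval 0 := by
    intro c
    have h1 : h.eval (η + e (c • w)) = h.eval 0 := by
      conv_lhs => rw [hconst, eval_C]
    rw [← h1]
    simp only [h, eval_finsetSum, eval_pow, eval_add, eval_X, eval_C]
    refine Finset.sum_congr rfl fun u _ => ?_
    change (η + e (E (c, u))) ^ n = _
    rw [hE, map_add, add_assoc]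
  simp_rw [this, Finset.sum_const, Finset.card_univ, nsmul_eq_mul]
  have h0 : (Fintype.card F : L) = 0 := by
    rw [← map_natCast (algebraMap F L), FiniteField.cast_card_eq_zero, map_zero]
  rw [h0, zero_mul]

/-- Every `F`-linear map on a finite `F`-subspace of `L` is interpolated by a `q`-polynomial. -/
theorem exists_qpolynomial_interpolation {e : U →ₗ[F] L} (he : Function.Injective e) {m : ℕ}
    (hm : Fintype.card U = Fintype.card F ^ m) (φ : U →ₗ[F] L) :
    ∃ g : Fin m → L, ∀ u, φ u = ∑ k, g k * e u ^ Fintype.card F ^ (k : ℕ) := by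
  classical
  have hq := Fintype.one_lt_card (α := F)
  have hfr : Module.finrank F U = m := by
    have h := Module.card_eq_pow_finrank (K := F) (V := U)
    rw [hm] at h
    exact (Nat.pow_right_injective hq h).symm
  let f : ℕ → (U →ₗ[F] L) := fun k => ((FiniteField.frobeniusAlgHom F L) ^ k).toLinearMap ∘ₗ e
  have hf : ∀ k u, f k u = e u ^ Fintype.card F ^ k := by
    intro k u
    change ((FiniteField.frobeniusAlgHom F L) ^ k) (e u) = _
    rw [AlgHom.coe_pow, FiniteField.coe_frobeniusAlgHom, pow_iterate]
  -- A nonzero q-polynomial of degree at most q^(m-1) cannot vanish at q^m points. The m independent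
  -- maps thus span Hom_F(U, L), which has L-dimension m.
  have hli : LinearIndependent L (fun k : Fin m => f k) := by
    rw [Fintype.linearIndependent_iff]
    intro g hg
    let p : L[X] := ∑ k : Fin m, C (g k) * X ^ Fintype.card F ^ (k : ℕ)
    have hp : p = 0 := by
      rcases Nat.eq_zero_or_pos m with rfl | hpos
      · simp [p]
      refine eq_zero_of_natDegree_lt_card_of_eval_eq_zero p he (fun u => ?_) ?_
      · have := LinearMap.congr_fun hg u
        simpa [p, eval_finsetSum, hf] using this
      · refine lt_of_le_of_lt (natDegree_sum_le_of_forall_le (n := Fintype.card F ^ (m - 1)) _ _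
          fun k _ => (natDegree_C_mul_X_pow_le _ _).trans ?_) ?_
        · exact Nat.pow_le_pow_right (by omega) (by omega)
        · rw [hm]; exact Nat.pow_lt_pow_right hq (by omega)
    intro k
    have h1 := congrArg (fun p => coeff p (Fintype.card F ^ (k : ℕ))) hp
    simp only [p, finsetSum_coeff, coeff_C_mul, coeff_X_pow, coeff_zero] at h1
    rw [Finset.sum_eq_single k] at h1
    · simpa using h1
    · intro j _ hjk
      rw [if_neg, mul_zero]
      intro h
      exact hjk (Fin.ext (Nat.pow_right_injective hq h).symm)
    · simp
  have hspan := hli.span_eq_top_of_card_eq_finrank' (by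
    rw [Module.finrank_linearMap, hfr]; simp)
  obtain ⟨g, hg⟩ := (Submodule.mem_span_range_iff_exists_fun L).1
    (hspan ▸ Submodule.mem_top : φ ∈ Submodule.span L (Set.range fun k : Fin m => f k))
  refine ⟨g, fun u => ?_⟩
  rw [← hg]
  simp [hf]

end

end

/-! ### The spaces A_{<d} and the monic elements as their cosets. -/

namespace RationalPlace

variable {F K : Type*} [Field F] [Field K] [Algebra F K] (P : RationalPlace F K)

/-- The subspace `A_{< d}` of elements of the base ring of degree less than `d`. -/
def ltDeg (d : ℕ) : Submodule F P.baseRing where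
  carrier := {a | P.val (a : K) < WithZero.exp (d : ℤ)}
  add_mem' ha hb := P.val.map_add_lt ha hb
  zero_mem' := by simp
  smul_mem' c a ha := by
    by_cases hc : c = 0
    · simp [hc]
    · change P.val (c • (a : K)) < _
      rw [P.val_smul hc]; exact ha

variable {P} in
theorem mem_ltDeg {d : ℕ} {a : P.baseRing} : a ∈ P.ltDeg d ↔ P.val (a : K) < WithZero.exp (d : ℤ) :=
  Iff.rfl

/-- The inclusion of `A_{< d}` in `K`. -/
def ltDegIncl (d : ℕ) : P.ltDeg d →ₗ[F] K := P.baseRing.val.toLinearMap ∘ₗ (P.ltDeg d).subtype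

variable {P} in
theorem ltDegIncl_injective (d : ℕ) : Function.Injective (P.ltDegIncl d) :=
  fun _ _ h => Subtype.ext (Subtype.ext h)

variable {P} in
@[simp] theorem ltDegIncl_apply {d : ℕ} (a : P.ltDeg d) :
    P.ltDegIncl d a = ((a : P.baseRing) : K) := rfl

variable [Fintype F]

noncomputable instance (d : ℕ) : Fintype (P.ltDeg d) := (P.finite_val_lt d).fintype

theorem absVal_of_val_eq_exp {x : K} {d : ℤ} (h : P.val x = WithZero.exp d) :
    P.absVal x = (Fintype.card F : ℝ) ^ d := by
  change (WithZeroMulInt.toNNReal _ (P.val x) : ℝ) = _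
  rw [h, WithZeroMulInt.toNNReal_neg_apply _ WithZero.exp_ne_zero]
  push_cast
  rfl

theorem absVal_lt_absVal {x y : K} : P.absVal x < P.absVal y ↔ P.val x < P.val y := by
  change (WithZeroMulInt.toNNReal _ (P.val x) : ℝ) < WithZeroMulInt.toNNReal _ (P.val y) ↔ _
  rw [NNReal.coe_lt_coe]
  exact (WithZeroMulInt.toNNReal_strictMono (one_lt_card (F := F))).lt_iff_lt

theorem absVal_lt_zpow {x : K} {d : ℤ} :
    P.absVal x < (Fintype.card F : ℝ) ^ d ↔ P.val x < WithZero.exp d := by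
  obtain ⟨y, hy⟩ := P.val_surjective (WithZero.exp d)
  rw [← P.absVal_of_val_eq_exp hy, absVal_lt_absVal, hy]

theorem absVal_le_zpow {x : K} {d : ℤ} :
    P.absVal x ≤ (Fintype.card F : ℝ) ^ d ↔ P.val x ≤ WithZero.exp d := by
  obtain ⟨y, hy⟩ := P.val_surjective (WithZero.exp d)
  rw [← P.absVal_of_val_eq_exp hy, ← not_lt, absVal_lt_absVal, hy, not_lt]

theorem absVal_eq_zpow {x : K} {d : ℤ} :
    P.absVal x = (Fintype.card F : ℝ) ^ d ↔ P.val x = WithZero.exp d := by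
  rw [le_antisymm_iff, le_antisymm_iff]
  exact and_congr P.absVal_le_zpow (by rw [← not_lt, absVal_lt_zpow, not_lt])

/-- K is dense in K_∞, so y may be replaced by a nearby element of K, where the residue field at ∞
is known to be F. -/
theorem exists_norm_sub_smul_lt {y : P.Kinf} (hy : y ≠ 0) {x : K}
    (h : ‖algebraMap K P.Kinf x‖ = ‖y‖) :
    ∃ c : F, c ≠ 0 ∧ ‖algebraMap K P.Kinf x - algebraMap F P.Kinf c * y‖ < ‖y‖ := by
  obtain ⟨z, hz⟩ : ∃ z : K, ‖algebraMap K P.Kinf z - y‖ < ‖y‖ := by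
    have hd : DenseRange (fun z : WithAbs P.absVal => (z : P.Kinf)) :=
      UniformSpace.Completion.denseRange_coe
    obtain ⟨z, hz⟩ := hd.exists_dist_lt y (norm_pos_iff.2 hy)
    refine ⟨z.ofAbs, ?_⟩
    rw [dist_comm, dist_eq_norm] at hz
    exact hz
  have hzy : ‖algebraMap K P.Kinf z‖ = ‖y‖ := by
    rw [sub_eq_add_neg] at hz
    have h1 := IsUltrametricDist.norm_eq_of_add_norm_lt_max (hz.trans_le
      ((norm_neg y).symm.le.trans (le_max_right _ _)))
    rwa [norm_neg] at h1
  have hz0 : z ≠ 0 := by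
    rintro rfl
    rw [map_zero, norm_zero] at hzy
    exact hy (norm_eq_zero.1 hzy.symm)
  have hval : P.val x ≤ P.val z := by
    rw [← not_lt, ← absVal_lt_absVal, ← norm_algebraMap, ← norm_algebraMap, h, hzy]
    exact lt_irrefl _
  obtain ⟨c, hc⟩ := P.exists_smul_sub_lt hz0 hval
  have hc' : ‖algebraMap K P.Kinf x - algebraMap F P.Kinf c * algebraMap K P.Kinf z‖ < ‖y‖ := by
    rw [← absVal_lt_absVal, ← norm_algebraMap, ← norm_algebraMap, hzy, map_sub,
      Algebra.smul_def, map_mul, ← IsScalarTower.algebraMap_apply F K P.Kinf] at hc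
    exact hc
  have hc0 : c ≠ 0 := by
    rintro rfl
    rw [map_zero, zero_mul, sub_zero, h] at hc'
    exact lt_irrefl _ hc'
  refine ⟨c, hc0, ?_⟩
  have : algebraMap K P.Kinf x - algebraMap F P.Kinf c * y =
      (algebraMap K P.Kinf x - algebraMap F P.Kinf c * algebraMap K P.Kinf z) +
        algebraMap F P.Kinf c * (algebraMap K P.Kinf z - y) := by ring
  rw [this]
  refine (IsUltrametricDist.norm_add_le_max _ _).trans_lt (max_lt hc' ?_)
  rwa [norm_mul, P.norm_algebraMap_base hc0, one_mul]

variable {P} {π : P.Kinf}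

theorem IsUniformizer.norm_zpow_neg (hπ : P.IsUniformizer π) (d : ℤ) :
    ‖π ^ (-d)‖ = (Fintype.card F : ℝ) ^ d := by
  rw [norm_zpow, hπ, inv_zpow, zpow_neg, inv_inv]

/-- A single inequality replaces the conditions on degree and sign, so that differences of monic
elements are handled by the ultrametric inequality. -/
theorem mem_monic_iff (hπ : P.IsUniformizer π) {d : ℕ} {a : P.baseRing} :
    a ∈ P.monic π d ↔
      ‖algebraMap K P.Kinf a - π ^ (-(d : ℤ))‖ < (Fintype.card F : ℝ) ^ (d : ℤ) := by
  have hq : (0 : ℝ) < Fintype.card F := by exact_mod_cast Fintype.card_pos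
  rw [monic, Set.Finite.mem_toFinset, Set.mem_ofPred_eq]
  constructor
  · rintro ⟨h1, h2⟩
    have hn : ‖algebraMap K P.Kinf (a : K)‖ = ‖π ^ (-(d : ℤ))‖ := by
      rw [norm_algebraMap, hπ.norm_zpow_neg, absVal_eq_zpow, h1]
    obtain ⟨c, hc, h⟩ := P.exists_norm_sub_smul_lt (y := π ^ (-(d : ℤ))) (x := a)
      (norm_pos_iff.1 (by rw [hπ.norm_zpow_neg]; positivity)) hn
    have h3 := P.sgn_eq_of_lt hπ hc (hn ▸ h)
    rw [h2] at h3
    rw [← h3, map_one, one_mul, hπ.norm_zpow_neg] at h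
    exact h
  · intro h
    have hn : ‖algebraMap K P.Kinf (a : K)‖ = (Fintype.card F : ℝ) ^ (d : ℤ) := by
      rw [← hπ.norm_zpow_neg, sub_eq_add_neg] at h
      have h1 := IsUltrametricDist.norm_eq_of_add_norm_lt_max (h.trans_le
        ((norm_neg _).symm.le.trans (le_max_right _ _)))
      rwa [norm_neg, hπ.norm_zpow_neg] at h1
    refine ⟨by rwa [norm_algebraMap, absVal_eq_zpow] at hn, P.sgn_eq_of_lt hπ one_ne_zero
      (n := -(d : ℤ)) ?_⟩
    rw [map_one, one_mul, hn]
    exact h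

theorem val_of_mem_monic {d : ℕ} {a : P.baseRing} (h : a ∈ P.monic π d) :
    P.val (a : K) = WithZero.exp (d : ℤ) := by
  rw [monic, Set.Finite.mem_toFinset] at h
  exact h.1

theorem ne_zero_of_mem_monic {d : ℕ} {a : P.baseRing} (h : a ∈ P.monic π d) : (a : K) ≠ 0 := by
  intro h0
  have := val_of_mem_monic h
  rw [h0, map_zero] at this
  exact WithZero.exp_ne_zero this.symm

theorem mem_monic_iff_sub_mem_ltDeg (hπ : P.IsUniformizer π) {d : ℕ} {η : P.baseRing}
    (hη : η ∈ P.monic π d) {a : P.baseRing} : a ∈ P.monic π d ↔ a - η ∈ P.ltDeg d := by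
  rw [mem_monic_iff hπ] at hη ⊢
  rw [mem_ltDeg, ← absVal_lt_zpow, ← norm_algebraMap]
  have h1 : algebraMap K P.Kinf ((a - η : P.baseRing) : K) =
      (algebraMap K P.Kinf a - π ^ (-(d : ℤ))) + -(algebraMap K P.Kinf η - π ^ (-(d : ℤ))) := by
    rw [AddSubgroupClass.coe_sub, map_sub]; ring
  constructor
  · intro h
    rw [h1]
    refine (IsUltrametricDist.norm_add_le_max _ _).trans_lt (max_lt h ?_)
    rwa [norm_neg]
  · intro h
    have h2 : algebraMap K P.Kinf a - π ^ (-(d : ℤ)) =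
      algebraMap K P.Kinf ((a - η : P.baseRing) : K) +
        (algebraMap K P.Kinf η - π ^ (-(d : ℤ))) := by rw [h1]; ring
    rw [h2]
    exact (IsUltrametricDist.norm_add_le_max _ _).trans_lt (max_lt h hη)

/-- The monic elements of degree `d` form a translate of `A_{< d}`. -/
theorem sum_monic_eq (hπ : P.IsUniformizer π) {M : Type*} [AddCommMonoid M] {d : ℕ}
    {η : P.baseRing} (hη : η ∈ P.monic π d) (g : P.baseRing → M) :
    ∑ a ∈ P.monic π d, g a = ∑ v : P.ltDeg d, g (η + v) := by
  refine Finset.sum_bij' (fun a ha => (⟨a - η, (mem_monic_iff_sub_mem_ltDeg hπ hη).1 ha⟩ :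
    P.ltDeg d)) (fun v _ => η + v) (fun _ _ => Finset.mem_univ _) (fun v _ => ?_) (fun a _ => ?_)
    (fun v _ => ?_) (fun a _ => ?_)
  · rw [mem_monic_iff_sub_mem_ltDeg hπ hη, add_sub_cancel_left]; exact v.2
  · simp
  · simp
  · simp

/-- Every nonzero element of the base ring is a unique scalar multiple of a monic one. -/
theorem exists_smul_mem_monic (hπ : P.IsUniformizer π) {d : ℕ} {a : P.baseRing}
    (ha : P.val (a : K) = WithZero.exp (d : ℤ)) : ∃ c : F, c ≠ 0 ∧ c • a ∈ P.monic π d := by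
  have hq : (0 : ℝ) < Fintype.card F := by exact_mod_cast Fintype.card_pos
  have hn : ‖algebraMap K P.Kinf (a : K)‖ = ‖π ^ (-(d : ℤ))‖ := by
    rw [norm_algebraMap, hπ.norm_zpow_neg, absVal_eq_zpow, ha]
  obtain ⟨c, hc, h⟩ := P.exists_norm_sub_smul_lt (y := π ^ (-(d : ℤ))) (x := a)
    (norm_pos_iff.1 (by rw [hπ.norm_zpow_neg]; positivity)) hn
  refine ⟨c⁻¹, inv_ne_zero hc, (mem_monic_iff hπ).2 ?_⟩
  have h1 : algebraMap K P.Kinf ((c⁻¹ • a : P.baseRing) : K) - π ^ (-(d : ℤ)) =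
      algebraMap F P.Kinf c⁻¹ * (algebraMap K P.Kinf a - algebraMap F P.Kinf c * π ^ (-(d : ℤ))) := by
    have : ((c⁻¹ • a : P.baseRing) : K) = c⁻¹ • (a : K) := rfl
    rw [this, Algebra.smul_def, map_mul, ← IsScalarTower.algebraMap_apply F K P.Kinf, mul_sub,
      ← mul_assoc, ← map_mul, inv_mul_cancel₀ hc, map_one, one_mul]
  rw [h1, norm_mul, P.norm_algebraMap_base (inv_ne_zero hc), one_mul, ← hπ.norm_zpow_neg]
  exact h

theorem eq_of_smul_mem_monic (hπ : P.IsUniformizer π) {d : ℕ} {a b : P.baseRing}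
    (ha : a ∈ P.monic π d) (hb : b ∈ P.monic π d) {c : F} (h : c • a = b) : c = 1 := by
  have h1 := (mem_monic_iff_sub_mem_ltDeg hπ ha).1 hb
  rw [← h, mem_ltDeg] at h1
  by_contra hc
  have h2 : ((c • a - a : P.baseRing) : K) = (c - 1) • (a : K) := by
    rw [sub_smul, one_smul]; rfl
  rw [h2, P.val_smul (sub_ne_zero.2 hc), val_of_mem_monic ha] at h1
  exact lt_irrefl _ h1

theorem monic_disjoint {d e : ℕ} {a : P.baseRing} (hd : a ∈ P.monic π d) (he : a ∈ P.monic π e) :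
    d = e := by
  have := (val_of_mem_monic hd).symm.trans (val_of_mem_monic he)
  rw [WithZero.exp_inj] at this
  exact_mod_cast this

/-- A sum of a homogeneous function of degree zero over `A_{≤ D} ∖ 0` is minus the sum over the
monic elements. -/
theorem sum_ltDeg_eq_neg_sum_monic (hπ : P.IsUniformizer π) {L : Type*} [Field L] [Algebra F L]
    (D : ℕ) (g : P.baseRing → L) (hg : ∀ (c : F) (a : P.baseRing), c ≠ 0 → g (c • a) = g a)
    (h0 : g 0 = 0) :
    ∑ v : P.ltDeg (D + 1), g v = -∑ j ∈ Finset.range (D + 1), ∑ a ∈ P.monic π j, g a := by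
  classical
  -- Each monic element has q - 1 nonzero scalar multiples, whence the sign.
  have hcard : ((Fintype.card Fˣ : ℕ) : L) = -1 := by
    rw [Fintype.card_units, Nat.cast_sub Fintype.card_pos, ← map_natCast (algebraMap F L),
      FiniteField.cast_card_eq_zero, map_zero, Nat.cast_one, zero_sub]
  have h1 : ∑ j ∈ Finset.range (D + 1), ∑ a ∈ P.monic π j, g a =
      ∑ a ∈ (Finset.range (D + 1)).biUnion (P.monic π), g a := by
    rw [Finset.sum_biUnion]
    intro i _ j _ hij
    exact Finset.disjoint_left.2 fun a ha hb => hij (monic_disjoint ha hb)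
  have h2 : ∑ p ∈ (Finset.univ : Finset Fˣ) ×ˢ (Finset.range (D + 1)).biUnion (P.monic π),
      g ((p.1 : F) • p.2) = -∑ j ∈ Finset.range (D + 1), ∑ a ∈ P.monic π j, g a := by
    rw [Finset.sum_product, h1]
    simp_rw [hg _ _ (Units.ne_zero _)]
    rw [Finset.sum_const, Finset.card_univ, nsmul_eq_mul, hcard, neg_one_mul]
  rw [← h2, ← Finset.sum_erase (a := (0 : P.ltDeg (D + 1))) _ (by simpa using h0)]
  symm
  have hmem : ∀ p ∈ (Finset.univ : Finset Fˣ) ×ˢ (Finset.range (D + 1)).biUnion (P.monic π),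
      ∃ j, j < D + 1 ∧ p.2 ∈ P.monic π j := by
    intro p hp
    simpa using hp
  have hval : ∀ p ∈ (Finset.univ : Finset Fˣ) ×ˢ (Finset.range (D + 1)).biUnion (P.monic π),
      (p.1 : F) • p.2 ∈ P.ltDeg (D + 1) := by
    intro p hp
    obtain ⟨j, hj, h⟩ := hmem p hp
    refine (P.ltDeg _).smul_mem _ ?_
    rw [mem_ltDeg, val_of_mem_monic h, WithZero.exp_lt_exp]
    exact_mod_cast hj
  refine Finset.sum_bij (fun p hp => (⟨(p.1 : F) • p.2, hval p hp⟩ : P.ltDeg (D + 1)))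
    (fun p hp => ?_) (fun p hp r hr h => ?_) (fun v hv => ?_) (fun p hp => rfl)
  · obtain ⟨j, hj, h⟩ := hmem p hp
    rw [Finset.mem_erase]
    refine ⟨fun h' => ne_zero_of_mem_monic h ?_, Finset.mem_univ _⟩
    have h3 : (p.1 : F) • p.2 = 0 := congrArg Subtype.val h'
    rw [(smul_eq_zero_iff_right (Units.ne_zero _)).1 h3]; rfl
  · obtain ⟨j, hj, h1⟩ := hmem p hp
    obtain ⟨k, hk, h2⟩ := hmem r hr
    have h3 : (p.1 : F) • p.2 = (r.1 : F) • r.2 := congrArg Subtype.val h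
    have hjk : j = k := by
      have h4 := congrArg (fun a : P.baseRing => P.val (a : K)) h3
      change P.val ((p.1 : F) • (p.2 : K)) = P.val ((r.1 : F) • (r.2 : K)) at h4
      rw [P.val_smul (Units.ne_zero _), P.val_smul (Units.ne_zero _), val_of_mem_monic h1,
        val_of_mem_monic h2, WithZero.exp_inj] at h4
      exact_mod_cast h4
    subst hjk
    have h5 : ((r.1⁻¹ * p.1 : Fˣ) : F) • p.2 = r.2 := by
      rw [Units.val_mul, mul_smul, h3, smul_smul, Units.inv_mul, one_smul]
    have h6 := eq_of_smul_mem_monic hπ h1 h2 h5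
    have h7 : p.1 = r.1 := by
      have := Units.ext (h6.trans Units.val_one.symm)
      rwa [inv_mul_eq_one, eq_comm] at this
    refine Prod.ext h7 ?_
    rw [h6, one_smul] at h5
    exact h5
  · rw [Finset.mem_erase] at hv
    have hv0 : ((v : P.baseRing) : K) ≠ 0 := fun h => hv.1 (Subtype.ext (Subtype.ext h))
    obtain ⟨d, hd⟩ := Int.eq_ofNat_of_zero_le (P.deg_nonneg (v : P.baseRing).2)
    have hvd := P.val_eq_exp_deg hv0
    rw [hd] at hvd
    obtain ⟨c, hc, hcm⟩ := exists_smul_mem_monic hπ hvd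
    have hdD : d < D + 1 := by
      have := mem_ltDeg.1 v.2
      rw [hvd, WithZero.exp_lt_exp] at this
      exact_mod_cast this
    refine ⟨((Units.mk0 c hc)⁻¹, c • (v : P.baseRing)), ?_, ?_⟩
    · simp only [Finset.mem_product, Finset.mem_univ, true_and, Finset.mem_biUnion,
        Finset.mem_range]
      exact ⟨d, hdD, hcm⟩
    · apply Subtype.ext
      simp [smul_smul, hc]

end RationalPlace

/-! ### The functional equation in coordinates. -/

namespace RationalPlace

theorem pow_mul_one_div {K : Type*} [Field K] {x : K} {n : ℕ} (hn : 2 ≤ n) : x ^ n * (1 / x) = x ^ (n - 1) := by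
  by_cases hx : x = 0
  · rw [hx, zero_pow (by omega), zero_pow (by omega), zero_mul]
  · rw [mul_one_div, div_eq_iff hx, ← pow_succ, Nat.sub_add_cancel (by omega)]

theorem frobenius_sum (F : Type*) [Field F] [Fintype F] {ι L : Type*} [Field L] [Algebra F L] (s : Finset ι) (f : ι → L) :
    (∑ i ∈ s, f i) ^ Fintype.card F = ∑ i ∈ s, f i ^ Fintype.card F :=
  map_sum (FiniteField.frobeniusAlgHom F L) f s

theorem frobenius_pow_add (F : Type*) [Field F] [Fintype F] {L : Type*} [Field L] [Algebra F L] (s : ℕ) (x y : L) :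
    (x + y) ^ Fintype.card F ^ s = x ^ Fintype.card F ^ s + y ^ Fintype.card F ^ s := by
  have h : ∀ z, ((FiniteField.frobeniusAlgHom F L) ^ s) z = z ^ Fintype.card F ^ s := fun z => by
    rw [AlgHom.coe_pow, FiniteField.coe_frobeniusAlgHom, pow_iterate]
  simp_rw [← h, map_add]

section

variable {F K : Type*} [Field F] [Field K] [Algebra F K] [Fintype F] {P : RationalPlace F K}
  {π : P.Kinf}

theorem card_ltDeg_succ {d : ℕ} {η : P.baseRing} (hη : P.val (η : K) = WithZero.exp (d : ℤ)) :
    Fintype.card (P.ltDeg (d + 1)) = Fintype.card F * Fintype.card (P.ltDeg d) := by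
  have hlt : WithZero.exp (d : ℤ) < WithZero.exp ((d + 1 : ℕ) : ℤ) := by
    rw [WithZero.exp_lt_exp]; push_cast; omega
  have hη0 : (η : K) ≠ 0 := fun h => by
    rw [h, map_zero] at hη; exact WithZero.exp_ne_zero hη.symm
  have hmem : ∀ (c : F) (v : P.ltDeg d), c • η + v ∈ P.ltDeg (d + 1) := fun c v =>
    (P.ltDeg (d + 1)).add_mem ((P.ltDeg (d + 1)).smul_mem _ (by rw [mem_ltDeg, hη]; exact hlt))
      ((mem_ltDeg.1 v.2).trans hlt)
  rw [← Fintype.card_prod]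
  symm
  refine Fintype.card_of_bijective
    (f := fun p : F × P.ltDeg d => (⟨p.1 • η + p.2, hmem p.1 p.2⟩ : P.ltDeg (d + 1))) ⟨?_, ?_⟩
  · rintro ⟨c, v⟩ ⟨c', v'⟩ h
    have h1 : c • η + (v : P.baseRing) = c' • η + v' := congrArg Subtype.val h
    have h2 : (c - c') • η = (v' - v : P.ltDeg d) := by
      rw [sub_smul, Submodule.coe_sub, sub_eq_sub_iff_add_eq_add, h1, add_comm]
    have hc : c = c' := by
      by_contra hne
      have h3 := mem_ltDeg.1 (v' - v).2
      rw [← h2] at h3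
      change P.val ((c - c') • (η : K)) < _ at h3
      rw [P.val_smul (sub_ne_zero.2 hne), hη] at h3
      exact lt_irrefl _ h3
    subst hc
    rw [add_right_inj] at h1
    rw [Subtype.ext h1]
  · intro a
    have hle : P.val ((a : P.baseRing) : K) ≤ P.val (η : K) := by
      rw [hη]
      by_cases h0 : ((a : P.baseRing) : K) = 0
      · rw [h0, map_zero]; exact zero_le
      · have := mem_ltDeg.1 a.2
        rw [P.val_eq_exp_deg h0, WithZero.exp_lt_exp] at this
        rw [P.val_eq_exp_deg h0, WithZero.exp_le_exp]
        push_cast at this; omega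
    obtain ⟨c, hc⟩ := P.exists_smul_sub_lt hη0 hle
    exact ⟨(c, ⟨a - c • η, by rw [mem_ltDeg, ← hη]; exact hc⟩), Subtype.ext (by simp)⟩

theorem sum_ltDeg_add_pow_eq_zero {d n : ℕ}
    (hn : (n + 1) * Fintype.card F ≤ Fintype.card (P.ltDeg d)) (η : K) :
    ∑ v : P.ltDeg d, (η + P.ltDegIncl d v) ^ n = 0 :=
  sum_add_pow_eq_zero (e := P.ltDegIncl d) (ltDegIncl_injective d) hn η

theorem sum_monic_pow_eq_zero (hπ : P.IsUniformizer π) {d n : ℕ}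
    (hn : (n + 1) * Fintype.card F ≤ Fintype.card (P.ltDeg d)) :
    ∑ a ∈ P.monic π d, (a : K) ^ n = 0 := by
  rcases (P.monic π d).eq_empty_or_nonempty with h | ⟨η, hη⟩
  · rw [h, Finset.sum_empty]
  · rw [sum_monic_eq hπ hη]
    exact sum_ltDeg_add_pow_eq_zero hn (η : K)

/-- This is the value of 𝒮_{≤D} at Ξ^{(k)}. The summand is invariant under F^×, so the sum is minus
the one over nonzero elements of A_{≤D}: a vanishing power sum of exponent q^k - 1 if k > 0, and
minus a count congruent to -1 if k = 0. -/
theorem sum_monic_le_pow_eq (hπ : P.IsUniformizer π) {D k : ℕ}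
    (hk : Fintype.card F ^ (k + 1) ≤ Fintype.card (P.ltDeg (D + 1))) :
    ∑ j ∈ Finset.range (D + 1), ∑ a ∈ P.monic π j, (a : K) ^ Fintype.card F ^ k * (1 / (a : K)) =
      if k = 0 then 1 else 0 := by
  classical
  have hq := Fintype.one_lt_card (α := F)
  have h := sum_ltDeg_eq_neg_sum_monic hπ D
    (fun a : P.baseRing => (a : K) ^ Fintype.card F ^ k * (1 / (a : K))) (fun c a hc => by
      have h1 : ((c • a : P.baseRing) : K) = algebraMap F K c * a := Algebra.smul_def _ _
      have hc' : algebraMap F K c ≠ 0 := by simpa using hc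
      simp only [h1]
      rw [mul_pow, ← map_pow, FiniteField.pow_card_pow]
      field_simp) (by simp)
  rw [eq_neg_iff_add_eq_zero, add_comm, ← eq_neg_iff_add_eq_zero] at h
  rw [h]
  split_ifs with hk0
  -- For k = 0 the summand is 1 except at v = 0, where 1/0 = 0 makes it vanish.
  · have h1 : ∀ v : P.ltDeg (D + 1), ((v : P.baseRing) : K) ^ Fintype.card F ^ k *
        (1 / ((v : P.baseRing) : K)) = (0 + P.ltDegIncl _ v) ^ 0 - if v = 0 then 1 else 0 := by
      intro v
      rw [hk0, pow_zero, pow_one, pow_zero]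
      split_ifs with hv
      · simp [hv]
      · rw [mul_one_div_cancel, sub_zero]
        exact fun h => hv (Subtype.ext (Subtype.ext h))
    simp_rw [h1, Finset.sum_sub_distrib]
    rw [sum_ltDeg_add_pow_eq_zero (by
      rw [hk0] at hk; simpa using hk)]
    simp
  · have hk2 : 2 ≤ Fintype.card F ^ k := hq.trans_le (Nat.le_self_pow hk0 _)
    simp_rw [pow_mul_one_div hk2]
    have h2 := sum_ltDeg_add_pow_eq_zero (P := P) (d := D + 1)
      (n := Fintype.card F ^ k - 1)
      (by rwa [Nat.sub_add_cancel (by omega), ← pow_succ]) (0 : K)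
    simp only [zero_add, ltDegIncl_apply] at h2
    rw [h2, neg_zero]

/-- The functional equation `𝒮_i^{(1)} = 𝒮_{≤ i} S_i(q - 1)`, coordinate by coordinate. -/
theorem sum_monic_coord_identity (hπ : P.IsUniformizer π) (φ : P.baseRing →ₗ[F] F) (i : ℕ) :
    ∑ a ∈ P.monic π i, algebraMap F K (φ a) * (1 / (a : K)) ^ Fintype.card F =
      (∑ j ∈ Finset.range (i + 1), ∑ a ∈ P.monic π j, algebraMap F K (φ a) * (1 / (a : K))) *
        P.powerSum π i (Fintype.card F - 1) := by
  classical
  have hq := Fintype.one_lt_card (α := F)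
  rcases (P.monic π i).eq_empty_or_nonempty with h | ⟨η, hη⟩
  · simp [powerSum, h]
  have hcard := card_ltDeg_succ (val_of_mem_monic hη)
  obtain ⟨m, hm⟩ : ∃ m, Fintype.card (P.ltDeg i) = Fintype.card F ^ m :=
    ⟨_, Module.card_eq_pow_finrank (K := F)⟩
  rw [hm, ← pow_succ'] at hcard
  obtain ⟨g, hg⟩ := exists_qpolynomial_interpolation
    (e := P.ltDegIncl (i + 1)) (ltDegIncl_injective (i + 1)) hcard
    (Algebra.linearMap F K ∘ₗ φ ∘ₗ (P.ltDeg (i + 1)).subtype)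
  have hφ : ∀ j ∈ Finset.range (i + 1), ∀ a ∈ P.monic π j, algebraMap F K (φ a) =
      ∑ k, g k * (a : K) ^ Fintype.card F ^ (k : ℕ) := fun j hj a ha =>
    hg ⟨a, by
      rw [mem_ltDeg, val_of_mem_monic ha, WithZero.exp_lt_exp]
      exact_mod_cast Finset.mem_range.1 hj⟩
  -- The values of 𝒮_{≤i} at Ξ^{(k)}, k ≤ m, extract the coefficient g_0.
  have hR : ∑ j ∈ Finset.range (i + 1), ∑ a ∈ P.monic π j,
      algebraMap F K (φ a) * (1 / (a : K)) = g 0 := by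
    have h1 : ∀ j ∈ Finset.range (i + 1), ∑ a ∈ P.monic π j, algebraMap F K (φ a) * (1 / (a : K)) =
        ∑ k, g k * ∑ a ∈ P.monic π j, (a : K) ^ Fintype.card F ^ (k : ℕ) * (1 / (a : K)) := by
      intro j hj
      simp_rw [Finset.mul_sum]
      rw [Finset.sum_comm]
      refine Finset.sum_congr rfl fun a ha => ?_
      rw [hφ j hj a ha, Finset.sum_mul]
      exact Finset.sum_congr rfl fun k _ => mul_assoc _ _ _
    rw [Finset.sum_congr rfl h1, Finset.sum_comm]
    simp_rw [← Finset.mul_sum]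
    have h2 : ∀ k : Fin (m + 1), g k * ∑ j ∈ Finset.range (i + 1), ∑ a ∈ P.monic π j,
        (a : K) ^ Fintype.card F ^ (k : ℕ) * (1 / (a : K)) = if k = 0 then g 0 else 0 := by
      intro k
      rw [sum_monic_le_pow_eq hπ (by
        rw [hcard]; exact Nat.pow_le_pow_right (by omega) (by omega))]
      by_cases hk : k = 0
      · simp [hk]
      · have hk0 : (k : ℕ) ≠ 0 := fun h => hk (Fin.ext h)
        rw [if_neg hk, if_neg hk0, mul_zero]
    simp_rw [h2]
    simp
  -- For k ≥ 1 the term a^(q^k)/a^q is the q-th power of a^(q^(k-1) - 1), an exponent small enough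
  -- for the sum over A_{+,i} to vanish.
  have hL : ∀ a ∈ P.monic π i, algebraMap F K (φ a) * (1 / (a : K)) ^ Fintype.card F =
      g 0 * (1 / (a : K) ^ (Fintype.card F - 1)) + ∑ k : Fin m, g k.succ *
        ((a : K) ^ (Fintype.card F ^ (k : ℕ) - 1)) ^ Fintype.card F := by
    intro a ha
    have ha0 := ne_zero_of_mem_monic ha
    rw [hφ i (Finset.self_mem_range_succ i) a ha, Finset.sum_mul, Fin.sum_univ_succ]
    congr 1
    · rw [Fin.val_zero, pow_zero, pow_one, mul_assoc]
      congr 1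
      obtain ⟨r, hr⟩ := Nat.exists_eq_add_of_le hq.le
      rw [hr, Nat.add_sub_cancel_left, one_div_pow, pow_add, pow_one]
      field_simp
    · refine Finset.sum_congr rfl fun k _ => ?_
      rw [mul_assoc, Fin.val_succ, pow_succ, pow_mul, ← mul_pow]
      congr 2
      rw [mul_one_div, div_eq_iff ha0, ← pow_succ, Nat.sub_add_cancel (Nat.one_le_pow _ _ (by omega))]
  rw [hR, Finset.sum_congr rfl hL, Finset.sum_add_distrib, ← Finset.mul_sum, Finset.sum_comm]
  rw [Finset.sum_eq_zero (s := (Finset.univ : Finset (Fin m))), add_zero, powerSum]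
  intro k _
  rw [← Finset.mul_sum, ← frobenius_sum F, sum_monic_pow_eq_zero hπ, zero_pow (by omega), mul_zero]
  rw [Nat.sub_add_cancel (Nat.one_le_pow _ _ (by omega)), ← pow_succ, hm]
  exact Nat.pow_le_pow_right (by omega) (by omega)

/-! ### Decay of the coefficients -/

/-- Put Q = q^s. Expanding η^Q = (η + v)^Q - v^Q in η^Q/(η + v)^(q-1) gives a power sum of exponent
Q - q + 1, which vanishes, and a remainder; the latter, divided by η^Q, is at most (q^(d-1)/q^d)^Q =
q^(-Q). -/
theorem val_powerSum_le (hπ : P.IsUniformizer π) {d s : ℕ} (hs : s ≠ 0)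
    (hcard : Fintype.card F ^ (s + 1) ≤ Fintype.card (P.ltDeg d)) :
    P.val (P.powerSum π d (Fintype.card F - 1)) ≤
      WithZero.exp (-((Fintype.card F ^ s : ℕ) : ℤ)) := by
  have hq := Fintype.one_lt_card (α := F)
  rcases (P.monic π d).eq_empty_or_nonempty with h | ⟨η, hη⟩
  · simp [powerSum, h]
  have hη0 := ne_zero_of_mem_monic hη
  set Q := Fintype.card F ^ s with hQ
  -- Here s ≠ 0 is needed, so that Q - (q - 1) is a true difference.
  have hqQ : Fintype.card F ≤ Q := Nat.le_self_pow hs _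
  have hterm : ∀ v : P.ltDeg d, 1 / ((η + v : P.baseRing) : K) ^ (Fintype.card F - 1) =
      ((η : K) ^ Q)⁻¹ * ((η : K) + P.ltDegIncl d v) ^ (Q - (Fintype.card F - 1)) -
        ((η : K) ^ Q)⁻¹ * (((v : P.baseRing) : K) ^ Q *
          (1 / ((η + v : P.baseRing) : K) ^ (Fintype.card F - 1))) := by
    intro v
    have hv : ((η + v : P.baseRing) : K) ≠ 0 := ne_zero_of_mem_monic (π := π) (d := d)
      ((mem_monic_iff_sub_mem_ltDeg hπ hη).2 (by rw [add_sub_cancel_left]; exact v.2))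
    have h1 : ((η + v : P.baseRing) : K) ^ Q = (η : K) ^ Q + ((v : P.baseRing) : K) ^ Q :=
      frobenius_pow_add F s _ _
    have h2 : ((η : K) + P.ltDegIncl d v) ^ (Q - (Fintype.card F - 1)) =
        ((η + v : P.baseRing) : K) ^ Q * (1 / ((η + v : P.baseRing) : K) ^ (Fintype.card F - 1)) := by
      rw [mul_one_div, eq_div_iff (pow_ne_zero _ hv)]
      exact (pow_add _ _ _).symm.trans (by rw [Nat.sub_add_cancel (by omega)]; rfl)
    rw [h2, h1]
    field_simp
    ring
  rw [powerSum, sum_monic_eq hπ hη, Finset.sum_congr rfl fun v _ => hterm v,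
    Finset.sum_sub_distrib, ← Finset.mul_sum, sum_ltDeg_add_pow_eq_zero, mul_zero,
    zero_sub, Valuation.map_neg]
  · refine P.val.map_sum_le fun v _ => ?_
    have hv : ((η + v : P.baseRing)) ∈ P.monic π d :=
      (mem_monic_iff_sub_mem_ltDeg hπ hη).2 (by rw [add_sub_cancel_left]; exact v.2)
    have h1 : P.val (1 / ((η + v : P.baseRing) : K) ^ (Fintype.card F - 1)) ≤ 1 := by
      rw [one_div, map_inv₀, map_pow, val_of_mem_monic hv]
      refine inv_le_one_of_one_le₀ (one_le_pow₀ ?_)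
      rw [← WithZero.exp_zero, WithZero.exp_le_exp]; omega
    have h2 : P.val ((v : P.baseRing) : K) ≤ WithZero.exp ((d : ℤ) - 1) := by
      by_cases h0 : ((v : P.baseRing) : K) = 0
      · rw [h0, map_zero]; exact zero_le
      · have := mem_ltDeg.1 v.2
        rw [P.val_eq_exp_deg h0, WithZero.exp_lt_exp] at this
        rw [P.val_eq_exp_deg h0, WithZero.exp_le_exp]
        omega
    rw [map_mul, map_mul, map_inv₀, map_pow, map_pow, val_of_mem_monic hη]
    calc _ ≤ (WithZero.exp (d : ℤ) ^ Q)⁻¹ * (WithZero.exp ((d : ℤ) - 1) ^ Q * 1) := by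
          gcongr
      _ = _ := by
          rw [mul_one, ← WithZero.exp_nsmul, ← WithZero.exp_nsmul, ← WithZero.exp_neg,
            ← WithZero.exp_add]
          congr 1
          simp only [nsmul_eq_mul]
          ring
  · refine le_trans (Nat.mul_le_mul_right _ ?_) ((pow_succ _ _).symm.le.trans hcard)
    omega

/-- Since φ(a)^q = φ(a), the q-th power is a coordinate of the twist of 𝒮_d, and the functional
equation transfers the bound on S_d(q-1) to it. -/
theorem val_sum_monic_le_pow (hπ : P.IsUniformizer π) {d s : ℕ} (hs : s ≠ 0)
    (hcard : Fintype.card F ^ (s + 1) ≤ Fintype.card (P.ltDeg d)) (φ : P.baseRing →ₗ[F] F) :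
    P.val (∑ a ∈ P.monic π d, algebraMap F K (φ a) * (1 / (a : K))) ^ Fintype.card F ≤
      WithZero.exp (-((Fintype.card F ^ s : ℕ) : ℤ)) := by
  rw [← map_pow, frobenius_sum F]
  simp_rw [mul_pow, ← map_pow, FiniteField.pow_card]
  rw [sum_monic_coord_identity hπ, map_mul]
  refine (mul_le_mul' ?_ (val_powerSum_le hπ hs hcard)).trans (one_mul _).le
  refine P.val.map_sum_le fun j _ => P.val.map_sum_le fun a ha => ?_
  rw [map_mul, one_div, map_inv₀, val_of_mem_monic ha]
  refine mul_le_one' (P.val_algebraMap_le _) (inv_le_one_of_one_le₀ ?_)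
  rw [← WithZero.exp_zero, WithZero.exp_le_exp]; omega

theorem card_ltDeg_mono {d e : ℕ} (h : d ≤ e) :
    Fintype.card (P.ltDeg d) ≤ Fintype.card (P.ltDeg e) := by
  refine Fintype.card_le_of_injective (fun v => ⟨v, (mem_ltDeg.1 v.2).trans_le ?_⟩)
    fun v w hvw => Subtype.ext (congrArg (fun x : P.ltDeg e => (x : P.baseRing)) hvw)
  rw [WithZero.exp_le_exp]; exact_mod_cast h

/-- The powers 1, x, ..., x^k have distinct degrees, all at most nk. -/
theorem pow_le_card_ltDeg {n : ℕ} (hn : n ≠ 0) {x : P.baseRing}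
    (hx : P.val (x : K) = WithZero.exp (n : ℤ)) (k : ℕ) :
    Fintype.card F ^ (k + 1) ≤ Fintype.card (P.ltDeg (n * k + 1)) := by
  have hpow : ∀ k : ℕ, P.val ((x ^ k : P.baseRing) : K) = WithZero.exp ((n * k : ℕ) : ℤ) := by
    intro k
    rw [SubmonoidClass.coe_pow, map_pow, hx, ← WithZero.exp_nsmul]
    congr 1
    simp only [nsmul_eq_mul]; push_cast; ring
  induction k with
  | zero =>
    rw [card_ltDeg_succ (hpow 0), zero_add, pow_one]
    exact Nat.le_mul_of_pos_right _ Fintype.card_pos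
  | succ k ih =>
    rw [card_ltDeg_succ (hpow (k + 1)), pow_succ']
    refine Nat.mul_le_mul_left _ (ih.trans (card_ltDeg_mono ?_))
    rw [mul_add]; omega

/-- A nonconstant x in A of degree n allows s = ⌊(d-1)/n⌋, and q^s eventually exceeds every linear
function of d. -/
theorem exists_pow_le_card_ltDeg [IsCurveFunctionField F K] (P : RationalPlace F K) (N : ℕ) :
    ∀ᶠ d : ℕ in atTop, ∃ s : ℕ, s ≠ 0 ∧ N * d ≤ Fintype.card F ^ s ∧
      Fintype.card F ^ (s + 1) ≤ Fintype.card (P.ltDeg d) := by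
  have hq := Fintype.one_lt_card (α := F)
  obtain ⟨x, hxA, hx⟩ := P.exists_mem_baseRing_one_lt_val
  have hx0 : x ≠ 0 := by rintro rfl; simp at hx
  obtain ⟨n, hn⟩ := Int.eq_ofNat_of_zero_le (P.deg_nonneg hxA)
  have hxn := P.val_eq_exp_deg hx0
  rw [hn] at hxn
  have hn0 : n ≠ 0 := by
    rintro rfl
    rw [hxn] at hx
    simp at hx
  refine eventually_atTop.2 ⟨n * (4 * (N * n) + 2) + 1, fun d hd => ⟨(d - 1) / n, ?_, ?_, ?_⟩⟩
  · have : 4 * (N * n) + 2 ≤ (d - 1) / n :=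
      (Nat.le_div_iff_mul_le (Nat.pos_of_ne_zero hn0)).2 (by rw [mul_comm]; omega)
    omega
  · set k := (d - 1) / n with hk
    have h1 : 4 * (N * n) + 2 ≤ k :=
      (Nat.le_div_iff_mul_le (Nat.pos_of_ne_zero hn0)).2 (by rw [mul_comm]; omega)
    have h2 : d ≤ n * (k + 1) := by
      have := Nat.lt_mul_div_succ (d - 1) (Nat.pos_of_ne_zero hn0)
      rw [← hk] at this
      omega
    have h3 : k / 2 + 1 ≤ 2 ^ (k / 2) := Nat.lt_two_pow_self
    calc N * d ≤ N * (n * (k + 1)) := Nat.mul_le_mul_left _ h2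
      _ ≤ (N * n) * (2 * (k / 2 + 1)) := by
          rw [← mul_assoc]; exact Nat.mul_le_mul_left _ (by omega)
      _ ≤ (k / 2 + 1) * (k / 2 + 1) := by
          rw [← mul_assoc]; exact Nat.mul_le_mul_right _ (by omega)
      _ ≤ 2 ^ (k / 2) * 2 ^ (k / 2) := Nat.mul_le_mul h3 h3
      _ = 2 ^ (k / 2 + k / 2) := (pow_add _ _ _).symm
      _ ≤ 2 ^ k := Nat.pow_le_pow_right (by omega) (by omega)
      _ ≤ Fintype.card F ^ k := Nat.pow_le_pow_left hq _
  · refine (pow_le_card_ltDeg (x := ⟨x, hxA⟩) hn0 hxn _).trans (card_ltDeg_mono ?_)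
    have := Nat.mul_div_le (d - 1) n
    omega

/-- The coefficients of `𝒮_d` tend to zero faster than any exponential in `d`. -/
theorem eventually_val_sum_monic_le [IsCurveFunctionField F K] (hπ : P.IsUniformizer π) (N : ℕ) :
    ∀ᶠ d : ℕ in atTop, ∀ φ : P.baseRing →ₗ[F] F,
      P.val (∑ a ∈ P.monic π d, algebraMap F K (φ a) * (1 / (a : K))) ≤
        WithZero.exp (-((N * d : ℕ) : ℤ)) := by
  have hq := Fintype.one_lt_card (α := F)
  -- The factor q compensates for the q-th root taken at the end.
  filter_upwards [P.exists_pow_le_card_ltDeg (Fintype.card F * N)] with d hd φ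
  obtain ⟨s, hs, h1, h2⟩ := hd
  have h3 := val_sum_monic_le_pow hπ hs h2 φ
  have h4 : WithZero.exp (-((Fintype.card F ^ s : ℕ) : ℤ)) ≤
      (WithZero.exp (-((N * d : ℕ) : ℤ))) ^ Fintype.card F := by
    rw [← WithZero.exp_nsmul, WithZero.exp_le_exp, nsmul_eq_mul, mul_neg, neg_le_neg_iff]
    rw [mul_assoc] at h1
    exact_mod_cast h1
  exact le_of_pow_le_pow_left₀ (by omega) zero_le (h3.trans h4)

end

end RationalPlace

/-! ### Coordinates in A ⊗ L and ultrametric norms. -/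

namespace RationalPlace
variable {F K : Type*} [Field F] [Field K] [Algebra F K] (P : RationalPlace F K)

theorem tensor_ext {L : Type*} [Field L] [Algebra F L] {x y : P.baseRing ⊗[F] L}
    (h : ∀ φ : P.baseRing →ₗ[F] F, TensorProduct.lid F L (φ.rTensor L x) =
      TensorProduct.lid F L (φ.rTensor L y)) : x = y := by
  classical
  let b := Module.Free.chooseBasis F P.baseRing
  apply (TensorProduct.equivFinsuppOfBasisLeft (N := L) b).injective
  ext i
  rw [TensorProduct.equivFinsuppOfBasisLeft_apply, TensorProduct.equivFinsuppOfBasisLeft_apply]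
  exact h _

variable {P} in
-- Basis elements of distinct degrees cannot cancel at top order, so the degree of a is the largest
-- degree in its support.
theorem val_le_of_coord_ne_zero {ι : Type*} (β : Module.Basis ι F P.baseRing)
    (hβ : Function.Injective fun i => P.deg (β i : K)) {a : P.baseRing}
    {i : ι} (h : β.coord i a ≠ 0) : P.val (β i : K) ≤ P.val (a : K) := by
  classical
  have hβ0 : ∀ i, (β i : K) ≠ 0 := fun i h => β.ne_zero i (Subtype.ext h)
  set s := (β.repr a).support with hs
  have hmem : i ∈ s := by rw [hs, Finsupp.mem_support_iff]; exact h
  obtain ⟨m, hm, hmax⟩ := s.exists_max_image (fun j => P.deg (β j : K)) ⟨i, hmem⟩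
  have hm0 : β.repr a m ≠ 0 := by rwa [hs, Finsupp.mem_support_iff] at hm
  have hle : P.val (β i : K) ≤ P.val (β m : K) := by
    rw [P.val_eq_exp_deg (hβ0 i), P.val_eq_exp_deg (hβ0 m), WithZero.exp_le_exp]
    exact hmax i hmem
  have hsum : (a : K) = ∑ j ∈ s, β.repr a j • (β j : K) := by
    conv_lhs => rw [← β.linearCombination_repr a, Finsupp.linearCombination_apply, Finsupp.sum]
    rw [AddSubmonoidClass.coe_finsetSum]
    rfl
  refine hle.trans (le_of_eq ?_)
  rw [hsum, ← Finset.add_sum_erase s _ hm, Valuation.map_add_eq_of_lt_left, P.val_smul hm0]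
  rw [P.val_smul hm0]
  refine P.val.map_sum_lt ((P.val.ne_zero_iff).2 (hβ0 m)) fun j hj => ?_
  have hj' := Finset.mem_of_mem_erase hj
  rw [hs, Finsupp.mem_support_iff] at hj'
  rw [P.val_smul hj', P.val_eq_exp_deg (hβ0 j), P.val_eq_exp_deg (hβ0 m), WithZero.exp_lt_exp]
  exact lt_of_le_of_ne (hmax j (Finset.mem_of_mem_erase hj)) fun h =>
    Finset.ne_of_mem_erase hj (hβ h)

variable {P} in
theorem finite_deg_lt {ι : Type*} (β : Module.Basis ι F P.baseRing)
    (hβ : Function.Injective fun i => P.deg (β i : K)) (D : ℕ) :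
    {i | P.deg (β i : K) < D}.Finite := by
  refine Set.Finite.of_finite_image (f := fun i => P.deg (β i : K))
    ((Set.finite_Ico (0 : ℤ) D).subset ?_) hβ.injOn
  rintro _ ⟨i, hi, rfl⟩
  exact ⟨P.deg_nonneg (β i).2, hi⟩

variable [Fintype F]

theorem norm_algebraMap_Cinf (x : K) : ‖algebraMap K P.Cinf x‖ = P.absVal x := by
  rw [← P.norm_algebraMap x, ← norm_algebraMap' P.KinfAlg (algebraMap K P.Kinf x),
    ← IsScalarTower.algebraMap_apply K P.Kinf P.KinfAlg]
  exact UniformSpace.Completion.norm_coe _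

instance : IsUltrametricDist P.KinfAlg :=
  IsUltrametricDist.isUltrametricDist_of_isNonarchimedean_norm
    (isNonarchimedean_spectralNorm (K := P.Kinf) (L := P.KinfAlg))

instance : IsUltrametricDist P.Cinf := by
  refine IsUltrametricDist.isUltrametricDist_of_forall_norm_add_le_max_norm fun x y => ?_
  induction x, y using UniformSpace.Completion.induction_on₂ with
  | hp => exact isClosed_le (by fun_prop) (by fun_prop)
  | ih x y =>
    rw [← UniformSpace.Completion.coe_add]
    simp only [UniformSpace.Completion.norm_coe]
    exact IsUltrametricDist.norm_add_le_max x y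
variable {P} {π : P.Kinf}

/-! ### The functional equation in the tensor product -/

theorem twist_calS (hπ : P.IsUniformizer π) (i : ℕ) :
    P.twist K (P.calS π i) =
      P.calSle π i * (1 ⊗ₜ[F] P.powerSum π i (Fintype.card F - 1)) := by
  refine P.tensor_ext fun φ => ?_
  have h := sum_monic_coord_identity hπ φ i
  have hL : TensorProduct.lid F K (φ.rTensor K (P.twist K (P.calS π i))) =
      ∑ a ∈ P.monic π i, algebraMap F K (φ a) * (1 / (a : K)) ^ Fintype.card F := by
    simp only [calS, twist, map_sum, Algebra.TensorProduct.map_tmul, LinearMap.rTensor_tmul,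
      TensorProduct.lid_tmul, Algebra.smul_def]
    rfl
  have hR : TensorProduct.lid F K (φ.rTensor K (P.calSle π i *
      (1 ⊗ₜ[F] P.powerSum π i (Fintype.card F - 1)))) =
      (∑ j ∈ Finset.range (i + 1), ∑ a ∈ P.monic π j, algebraMap F K (φ a) * (1 / (a : K))) *
        P.powerSum π i (Fintype.card F - 1) := by
    simp only [calSle, calS, Finset.sum_mul, map_sum, Algebra.TensorProduct.tmul_mul_tmul, mul_one,
      LinearMap.rTensor_tmul, TensorProduct.lid_tmul, Algebra.smul_def, mul_assoc]
  rw [hL, hR, h]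

/-! ### Coefficients of the series -/

section Tate

variable {ι : Type*} (β : Module.Basis ι F P.baseRing)

theorem calSTate_apply (d : ℕ) (i : ι) : (P.calSTate β π d).1 i =
    algebraMap K P.Cinf (∑ a ∈ P.monic π d, algebraMap F K (β.coord i a) * (1 / (a : K))) := by
  change TensorProduct.lid F P.Cinf ((β.coord i).rTensor P.Cinf (Algebra.TensorProduct.map
    (AlgHom.id F P.baseRing) (IsScalarTower.toAlgHom F K P.Cinf) (P.calS π d))) = _
  simp only [calS, map_sum, Algebra.TensorProduct.map_tmul, LinearMap.rTensor_tmul,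
    TensorProduct.lid_tmul, Algebra.smul_def, map_mul]
  refine Finset.sum_congr rfl fun a _ => ?_
  rw [← IsScalarTower.algebraMap_apply F K P.Cinf]
  rfl

theorem calSTate_apply_eq_zero (hβ : Function.Injective fun i => P.deg (β i : K)) {d : ℕ} {i : ι}
    (h : (d : ℤ) < P.deg (β i : K)) : (P.calSTate β π d).1 i = 0 := by
  rw [calSTate_apply, Finset.sum_eq_zero, map_zero]
  intro a ha
  have h0 : β.coord i a = 0 := by
    by_contra hne
    have h1 := val_le_of_coord_ne_zero β hβ hne
    have hβ0 : (β i : K) ≠ 0 := fun h => β.ne_zero i (Subtype.ext h)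
    rw [P.val_eq_exp_deg hβ0, val_of_mem_monic ha, WithZero.exp_le_exp] at h1
    omega
  rw [h0, map_zero, zero_mul]

/-- Choosing N with ρ < q^N turns the bound q^(-Nd) into geometric decay, uniformly in the
coordinate. -/
theorem eventually_norm_calSTate_mul_pow_lt [IsCurveFunctionField F K] (hπ : P.IsUniformizer π)
    {ρ : ℝ} (hρ : 1 ≤ ρ) {ε : ℝ} (hε : 0 < ε) :
    ∀ᶠ d : ℕ in atTop, ∀ i, ‖(P.calSTate β π d).1 i‖ * ρ ^ d < ε := by
  have hq : (1 : ℝ) < Fintype.card F := by exact_mod_cast Fintype.one_lt_card (α := F)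
  obtain ⟨N, hN⟩ := pow_unbounded_of_one_lt ρ hq
  have hr0 : 0 ≤ ρ / (Fintype.card F : ℝ) ^ N := by positivity
  have hr1 : ρ / (Fintype.card F : ℝ) ^ N < 1 := (div_lt_one (by positivity)).2 hN
  have ht := (tendsto_pow_atTop_nhds_zero_of_lt_one hr0 hr1).eventually_lt_const hε
  filter_upwards [ht, eventually_val_sum_monic_le hπ N] with d hd hv i
  refine lt_of_le_of_lt ?_ hd
  rw [calSTate_apply, norm_algebraMap_Cinf, div_pow, div_eq_inv_mul]
  refine mul_le_mul_of_nonneg_right ?_ (by positivity)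
  refine (P.absVal_le_zpow.2 (hv (β.coord i))).trans (le_of_eq ?_)
  rw [zpow_neg, zpow_natCast, pow_mul]

instance : CompleteSpace (P.tate ι) := by
  have hcl : IsClosed (P.tate ι : Set (lp (fun _ : ι => P.Cinf) ∞)) := by
    rw [← isSeqClosed_iff_isClosed]
    intro u f hu hf
    change Tendsto (fun i => f i) cofinite (𝓝 0)
    rw [Metric.tendsto_nhds]
    intro ε hε
    obtain ⟨n, hn⟩ := ((Metric.tendsto_nhds.1 hf) (ε / 2) (half_pos hε)).exists
    have h1 : Tendsto (fun i => u n i) cofinite (𝓝 0) := hu n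
    filter_upwards [(Metric.tendsto_nhds.1 h1) (ε / 2) (half_pos hε)] with i hi
    rw [dist_zero_right] at hi ⊢
    have h2 := lp.norm_apply_le_norm ENNReal.top_ne_zero (u n - f) i
    rw [← dist_eq_norm, lp.coeFn_sub, Pi.sub_apply] at h2
    calc ‖f i‖ = ‖u n i - (u n i - f i)‖ := by rw [sub_sub_cancel]
      _ ≤ ‖u n i‖ + ‖u n i - f i‖ := norm_sub_le _ _
      _ < ε / 2 + ε / 2 := add_lt_add_of_lt_of_le hi (h2.trans hn.le)
      _ = ε := add_halves ε
  exact hcl.completeSpace_coe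

theorem summable_calSTate [IsCurveFunctionField F K] (hπ : P.IsUniformizer π) :
    Summable fun d : ℕ => P.calSTate β π d := by
  refine Summable.of_norm_bounded_eventually_nat (g := fun d : ℕ => (1 / 2 : ℝ) ^ d)
    summable_geometric_two ?_
  filter_upwards [eventually_norm_calSTate_mul_pow_lt β hπ (one_le_two (α := ℝ)) one_pos] with d hd
  refine lp.norm_le_of_forall_le (by positivity) fun i => ?_
  rw [one_div, inv_pow, ← one_div, le_div_iff₀ (by positivity)]
  exact (hd i).le

theorem hasSum_Z₀_apply [IsCurveFunctionField F K] (hπ : P.IsUniformizer π) (i : ι) :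
    HasSum (fun d => (P.calSTate β π d).1 i) ((P.Z₀ β π).1 i) := by
  let ev : P.tate ι →+ P.Cinf :=
    { toFun := fun f => f.1 i
      map_zero' := rfl
      map_add' := fun _ _ => rfl }
  have hev : Continuous ev := by
    refine AddMonoidHomClass.continuous_of_bound ev 1 fun f => ?_
    rw [one_mul]
    exact lp.norm_apply_le_norm ENNReal.top_ne_zero f.1 i
  exact (summable_calSTate β hπ).hasSum.map ev hev

theorem norm_le_of_hasSum {α : Type*} {f : α → P.Cinf} {x : P.Cinf} (h : HasSum f x) {C : ℝ}
    (hC : 0 ≤ C) (hf : ∀ a, ‖f a‖ ≤ C) : ‖x‖ ≤ C :=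
  le_of_tendsto h.norm (Eventually.of_forall fun _ =>
    IsUltrametricDist.norm_sum_le_of_forall_le_of_nonneg hC fun a _ => hf a)

theorem isEntire_Z₀ [IsCurveFunctionField F K] (hπ : P.IsUniformizer π)
    (hβ : Function.Injective fun i => P.deg (β i : K)) : P.IsEntire β (P.Z₀ β π) := by
  intro ρ hρ
  have hρ0 : 0 < ρ := one_pos.trans hρ
  rw [Metric.tendsto_nhds]
  intro ε hε
  obtain ⟨D, hD⟩ := eventually_atTop.1
    (eventually_norm_calSTate_mul_pow_lt β hπ hρ.le (half_pos hε))
  rw [eventually_cofinite]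
  refine (finite_deg_lt β hβ D).subset fun i hi => ?_
  by_contra hlt
  apply hi
  obtain ⟨n, hn⟩ := Int.eq_ofNat_of_zero_le (P.deg_nonneg (β i).2)
  rw [Set.mem_ofPred_eq, hn, not_lt] at hlt
  have hDn : D ≤ n := by exact_mod_cast hlt
  rw [dist_zero_right, Real.norm_of_nonneg (by positivity), hn]
  -- Only the 𝒮_d with d ≥ n = deg β_i contribute to this coefficient, and ρ^n ≤ ρ^d for them.
  have h1 : ‖(P.Z₀ β π).1 i‖ ≤ ε / 2 / ρ ^ n := by
    refine norm_le_of_hasSum (hasSum_Z₀_apply β hπ i) (by positivity) fun d => ?_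
    rcases lt_or_ge d n with hdn | hdn
    · rw [calSTate_apply_eq_zero β hβ (by rw [hn]; exact_mod_cast hdn), norm_zero]
      positivity
    · rw [le_div_iff₀ (by positivity)]
      refine le_trans ?_ (hD d (hDn.trans hdn) i).le
      exact mul_le_mul_of_nonneg_left (pow_le_pow_right₀ hρ.le hdn) (norm_nonneg _)
  rw [le_div_iff₀ (by positivity)] at h1
  calc _ ≤ ε / 2 := h1
    _ < ε := half_lt_self hε

/-! ### Values at the twists of `Ξ` -/

theorem frob_iterate_Xi_apply (k : ℕ) (a : P.baseRing) :
    (P.frob^[k] P.Xi) a = algebraMap K P.Cinf ((a : K) ^ Fintype.card F ^ k) := by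
  induction k with
  | zero => rw [Function.iterate_zero, id, pow_zero, pow_one]; rfl
  | succ k ih =>
    rw [Function.iterate_succ_apply']
    change ((P.frob^[k] P.Xi) a) ^ Fintype.card F = _
    rw [ih, ← map_pow, ← pow_mul, ← pow_succ]

theorem norm_frob_iterate_Xi_basis (k : ℕ) (i : ι) :
    ‖(P.frob^[k] P.Xi) (β i)‖ =
      ((Fintype.card F : ℝ) ^ Fintype.card F ^ k) ^ (P.deg (β i : K)) := by
  have hβ0 : (β i : K) ≠ 0 := fun h => β.ne_zero i (Subtype.ext h)
  rw [frob_iterate_Xi_apply, norm_algebraMap_Cinf, map_pow,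
    P.absVal_of_val_eq_exp (P.val_eq_exp_deg hβ0), ← zpow_natCast, ← zpow_natCast, ← zpow_mul,
    ← zpow_mul, mul_comm]

theorem hasSum_coord_mul (x : P.Point) (a : P.baseRing) :
    HasSum (fun i => algebraMap F P.Cinf (β.coord i a) * x (β i)) (x a) := by
  have h : x a = ∑ i ∈ (β.repr a).support, algebraMap F P.Cinf (β.coord i a) * x (β i) := by
    conv_lhs => rw [← β.linearCombination_repr a, Finsupp.linearCombination_apply, Finsupp.sum]
    rw [map_sum]
    refine Finset.sum_congr rfl fun i _ => ?_
    rw [map_smul, Algebra.smul_def]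
    rfl
  rw [h]
  refine hasSum_sum_of_ne_finset_zero fun i hi => ?_
  rw [Finsupp.notMem_support_iff] at hi
  change algebraMap F P.Cinf (β.repr a i) * _ = 0
  rw [hi, map_zero, zero_mul]

theorem hasSum_calSTate_apply_mul (k d : ℕ) :
    HasSum (fun i => (P.calSTate β π d).1 i * (P.frob^[k] P.Xi) (β i))
      (algebraMap K P.Cinf (∑ a ∈ P.monic π d, (a : K) ^ Fintype.card F ^ k * (1 / (a : K)))) := by
  have h := hasSum_sum (s := P.monic π d) fun a _ =>
    (hasSum_coord_mul β (P.frob^[k] P.Xi) a).mul_right (algebraMap K P.Cinf (1 / (a : K)))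
  have h1 : (fun i => (P.calSTate β π d).1 i * (P.frob^[k] P.Xi) (β i)) = fun i =>
      ∑ a ∈ P.monic π d, algebraMap F P.Cinf (β.coord i a) * (P.frob^[k] P.Xi) (β i) *
        algebraMap K P.Cinf (1 / (a : K)) := by
    funext i
    rw [calSTate_apply, map_sum, Finset.sum_mul]
    refine Finset.sum_congr rfl fun a _ => ?_
    rw [map_mul, ← IsScalarTower.algebraMap_apply F K P.Cinf]
    ring
  have h2 : algebraMap K P.Cinf (∑ a ∈ P.monic π d, (a : K) ^ Fintype.card F ^ k * (1 / (a : K))) =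
      ∑ a ∈ P.monic π d, (P.frob^[k] P.Xi) a * algebraMap K P.Cinf (1 / (a : K)) := by
    rw [map_sum]
    refine Finset.sum_congr rfl fun a _ => ?_
    rw [map_mul, frob_iterate_Xi_apply]
  rw [h1, h2]
  exact h

/-- Nonzero terms have deg β_i ≤ d, so the growth q^(q^k deg β_i) of the value of β_i is absorbed by
ρ^d with ρ = q^(q^k). In a complete ultrametric group, terms tending to zero suffice for
summability. -/
theorem summable_calSTate_apply_mul [IsCurveFunctionField F K] (hπ : P.IsUniformizer π)
    (hβ : Function.Injective fun i => P.deg (β i : K)) (k : ℕ) :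
    Summable fun p : ι × ℕ => (P.calSTate β π p.2).1 p.1 * (P.frob^[k] P.Xi) (β p.1) := by
  have hq := Fintype.one_lt_card (α := F)
  have hq' : (1 : ℝ) ≤ Fintype.card F := by exact_mod_cast hq.le
  set ρ : ℝ := (Fintype.card F : ℝ) ^ Fintype.card F ^ k with hρ
  have hρ1 : 1 ≤ ρ := one_le_pow₀ hq'
  refine NonarchimedeanAddGroup.summable_of_tendsto_cofinite_zero ?_
  rw [Metric.tendsto_nhds]
  intro ε hε
  obtain ⟨D, hD⟩ := eventually_atTop.1 (eventually_norm_calSTate_mul_pow_lt β hπ hρ1 hε)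
  rw [eventually_cofinite]
  refine ((finite_deg_lt β hβ D).prod (Set.finite_Iio D)).subset ?_
  rintro ⟨i, d⟩ hid
  obtain ⟨n, hn⟩ := Int.eq_ofNat_of_zero_le (P.deg_nonneg (β i).2)
  rw [Set.mem_ofPred_eq, dist_zero_right] at hid
  simp only at hid
  rw [norm_mul, norm_frob_iterate_Xi_basis, ← hρ, hn, not_lt] at hid
  have hnd : n ≤ d := by
    by_contra hlt
    rw [calSTate_apply_eq_zero β hβ (by rw [hn]; exact_mod_cast not_le.1 hlt), norm_zero,
      zero_mul] at hid
    exact absurd hid (not_le.2 hε)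
  have hdD : d < D := by
    by_contra hge
    refine absurd (hD d (not_lt.1 hge) i) (not_lt.2 (hid.trans ?_))
    exact mul_le_mul_of_nonneg_left (pow_le_pow_right₀ hρ1 hnd) (norm_nonneg _)
  refine ⟨?_, hdD⟩
  rw [Set.mem_ofPred_eq, hn]
  exact_mod_cast hnd.trans_lt hdD

/-- Summing the double family over d first gives the value of Z_0; summing over i first gives the
series of values of the 𝒮_d, whose partial sums are eventually constant. -/
theorem hasValueAt_Z₀ [IsCurveFunctionField F K] (hπ : P.IsUniformizer π)
    (hβ : Function.Injective fun i => P.deg (β i : K)) (k : ℕ) :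
    P.HasValueAt β (P.Z₀ β π) (P.frob^[k] P.Xi) (if k = 0 then 1 else 0) := by
  have hq := Fintype.one_lt_card (α := F)
  obtain ⟨y, hy⟩ := summable_calSTate_apply_mul β hπ hβ k
  have h1 : P.HasValueAt β (P.Z₀ β π) (P.frob^[k] P.Xi) y :=
    HasSum.prod_fiberwise hy fun i => (hasSum_Z₀_apply β hπ i).mul_right ((P.frob^[k] P.Xi) (β i))
  have h2 : HasSum (fun d => algebraMap K P.Cinf
      (∑ a ∈ P.monic π d, (a : K) ^ Fintype.card F ^ k * (1 / (a : K)))) y :=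
    ((Equiv.prodComm ℕ ι).hasSum_iff.2 hy).prod_fiberwise fun d => hasSum_calSTate_apply_mul β k d
  have h3 : ∀ᶠ n : ℕ in atTop, ∑ d ∈ Finset.range n, algebraMap K P.Cinf
      (∑ a ∈ P.monic π d, (a : K) ^ Fintype.card F ^ k * (1 / (a : K))) =
      if k = 0 then 1 else 0 := by
    -- The factor q^k forces q^k ≤ q^s, hence k ≤ s, which makes A_{<n} large enough for the
    -- vanishing at Ξ^{(k)}.
    filter_upwards [P.exists_pow_le_card_ltDeg (Fintype.card F ^ k), eventually_gt_atTop 0]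
      with n hn hn0
    obtain ⟨s, -, hs1, hs2⟩ := hn
    obtain ⟨D, rfl⟩ := Nat.exists_eq_succ_of_ne_zero hn0.ne'
    rw [← map_sum, sum_monic_le_pow_eq hπ]
    · split_ifs <;> simp
    · have h4 : Fintype.card F ^ k ≤ Fintype.card F ^ s :=
        (Nat.le_mul_of_pos_right _ hn0).trans hs1
      have h5 : k ≤ s := (Nat.pow_le_pow_iff_right hq).1 h4
      exact (Nat.pow_le_pow_right (by omega) (by omega)).trans hs2
  have h6 : y = if k = 0 then 1 else 0 :=
    tendsto_nhds_unique h2.tendsto_sum_nat (tendsto_nhds_of_eventually_eq h3)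
  rwa [h6] at h1

end Tate

end RationalPlace

theorem mainTheorem3 {F K : Type*} [Field F] [Fintype F] [Field K] [Algebra F K]
    [IsCurveFunctionField F K] (P : RationalPlace F K) (π : P.Kinf) (hπ : P.IsUniformizer π) :
    (∀ i : ℕ, P.twist K (P.calS π i) =
      P.calSle π i * (1 ⊗ₜ[F] P.powerSum π i (Fintype.card F - 1))) ∧
    (∀ (ι : Type*) (β : Module.Basis ι F P.baseRing),
      Function.Injective (fun i => P.deg (β i : K)) →
        Summable (fun d : ℕ => P.calSTate β π d) ∧
        P.IsEntire β (P.Z₀ β π) ∧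
        (∀ k : ℕ, 1 ≤ k → P.HasValueAt β (P.Z₀ β π) (P.frob^[k] P.Xi) 0) ∧
        P.HasValueAt β (P.Z₀ β π) P.Xi 1) := by
  refine ⟨fun i => RationalPlace.twist_calS hπ i, fun ι β hβ => ⟨RationalPlace.summable_calSTate β hπ,
    RationalPlace.isEntire_Z₀ β hπ hβ, fun k hk => ?_, ?_⟩⟩
  · have h := RationalPlace.hasValueAt_Z₀ β hπ hβ k
    rwa [if_neg (by omega)] at h
  · exact RationalPlace.hasValueAt_Z₀ β hπ hβ 0
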